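/- **Setting.** A *tile* is a subset of $\mathbb{R}^2$ homeomorphic to the closed unit disk. A *tiling* of $\Lambda\subseteq\mathbb{R}^2$ is a countable collection of tiles with union $\Lambda$ and pairwise disjoint interiors. Let $\mathcal{E}$ be a group of isometries of the plane containing all translations. An *$\mathcal{E}$-copy* of a set $p$ is a set $g(p)$ with $g\in\mathcal{E}$. Let $\mathcal{P}=\{p_1,\dots,p_n\}$ be a finite collection of tiles, no two of which are $\mathcal{E}$-copies of each other, and let $\Omega_{\mathcal{E},\mathcal{P}}(\Lambda)$ be the set of tilings of $\Lambda$ all of whose tiles are $\mathcal{E}$-copies of elements of $\mathcal{P}$. A *planar substitution rule* with dilation factor $\lambda>1$ is a collection $\mathcal{S}=(\mathcal{S}_i)_{i=1}^n$ with $\mathcal{S}_i\in\Omega_{\mathcal{E},\mathcal{P}}(\lambda p_i)$. Its *substitution matrix* $M_{\mathcal{S}}$ has as $(i,j)$ entry the number of $\mathcal{E}$-copies of $p_i$ in $\mathcal{S}_j$. The *substitution map* $\mathcal{I}_{\mathcal{S}}$ on $\Omega_{\mathcal{E},\mathcal{P}}(\mathbb{R}^2)$ dilates a tiling by $\lambda$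 and replaces each dilated tile $g(\lambda p_i)$, $g\in\mathcal{E}$, by the tiles $g(s)$, $s\in\mathcal{S}_i$. (If the choice of $g$ matters because $\lambda p_i$ has symmetries in $\mathcal{E}$ that do not preserve $\mathcal{S}_i$, then $g$ may be chosen freely for each tile and $\mathcal{I}_{\mathcal{S}}$ is multivalued.) A tiling is *admissible* if it belongs to $\Omega_{\mathcal{S}}=\bigcap_{k\ge 0}\mathcal{I}_{\mathcal{S}}^k(\Omega_{\mathcal{E},\mathcal{P}}(\mathbb{R}^2))$. A nonnegative square matrix is *primitive* if one of its powers $M^k$, $k>0$, has only positive entries. For a primitive matrix $M$ let $\mu$ be its Perron eigenvalue (its largest real eigenvalue) and let $r(M)=\max\{|\eta| : \eta\neq\mu \text{ a complex eigenvalue of } M\}$, with $r(M)=0$ if there is no such $\eta$. An eigenvalue is *semi-simple* if its algebraic and geometric multiplicities coincide. For a Jordan curve $\Gamma$ bounding a topological closed disk $\Delta$ and a tiling $\mathcal{T}$ of the plane, let $\mathcal{L}(\Gamma,\mathcal{T})$ be the number of tiles of $\mathcal{T}$ that meet $\Gamma$, $\mathcal{N}(\Delta,\mathcal{T})$ the number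 of tiles of $\mathcal{T}$ included in $\Delta$, and $\mathcal{N}(\Delta,\mathcal{T},p_i)$ the number of those that are $\mathcal{E}$-copies of $p_i$. **Theorem 1.** Let $M$ be a primitive $n\times n$ matrix with nonnegative integer entries. There exist positive numbers $\nu_1,\dots,\nu_n$, depending only on $M$, such that every planar substitution rule $\mathcal{S}$ (for any $\mathcal{E}$, $\mathcal{P}$ and dilation factor $\lambda>1$) with substitution matrix $M_{\mathcal{S}}=M$ satisfies the following. For every Jordan curve $\Gamma$ bounding a topological closed disk $\Delta$ and every $\mathcal{T}\in\Omega_{\mathcal{S}}$, the numbers $\mathcal{N}(\Delta,\mathcal{T})$ and $\mathcal{L}(\Gamma,\mathcal{T})$ are finite. Moreover: (i) If $r(M)<\lambda$, then there exists $K>0$ such that, for every Jordan curve $\Gamma$ bounding a topological closed disk $\Delta$, every $\mathcal{T}\in\Omega_{\mathcal{S}}$ and every $i\in\{1,\dots,n\}$, $$|\mathcal{N}(\Delta,\mathcal{T},p_i)-\nu_i\,\mathcal{N}(\Delta,\mathcal{T})|\le K\,\mathcal{L}(\Gamma,\mathcal{T}).$$ (ii) If $r(M)=\lambda$ and all eigenvalues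 of $M$ of modulus $\lambda$ are semi-simple, then there exists $K>0$ such that, for every Jordan curve $\Gamma$ bounding a topological closed disk $\Delta$, every $\mathcal{T}\in\Omega_{\mathcal{S}}$ and every $i\in\{1,\dots,n\}$, $$|\mathcal{N}(\Delta,\mathcal{T},p_i)-\nu_i\,\mathcal{N}(\Delta,\mathcal{T})|\le K\,\mathcal{L}(\Gamma,\mathcal{T})\,\ln\mathcal{L}(\Gamma,\mathcal{T}).$$ -/

import Mathlib

open scoped Pointwise

noncomputable section

/-- The Euclidean plane. -/
abbrev Plane : Type := EuclideanSpace ℝ (Fin 2)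

/-- A tile (topological closed disk): a subset of the plane which is homeomorphic to the closed
unit ball.  Such a set is compact, hence closed. -/
def IsClosedDisk (t : Set Plane) : Prop :=
  Nonempty (t ≃ₜ Metric.closedBall (0 : Plane) 1)

/-- A tiling of a subset `Λ` of the plane: a countable collection of tiles contained in `Λ`,
covering `Λ`, whose interiors are pairwise disjoint. -/
structure IsTiling (Λ : Set Plane) (T : Set (Set Plane)) : Prop where
  countable : T.Countable
  isTile : ∀ t ∈ T, IsClosedDisk t
  cover : ⋃₀ T = Λ
  disjoint : ∀ t ∈ T, ∀ t' ∈ T, t ≠ t' → Disjoint (interior t) (interior t')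

/-- `q` is an `E`-copy of `p`: the image of `p` by an isometry belonging to `E`. -/
def IsCopy (E : Subgroup (Plane ≃ᵢ Plane)) (p q : Set Plane) : Prop :=
  ∃ g ∈ E, g '' p = q

/-- The set of all tilings of `Λ` that are `E`-generated by the prototiles `p i`. -/
def generatedTilings (E : Subgroup (Plane ≃ᵢ Plane)) {n : ℕ} (p : Fin n → Set Plane)
    (Λ : Set Plane) : Set (Set (Set Plane)) :=
  {T | IsTiling Λ T ∧ ∀ t ∈ T, ∃ i, IsCopy E (p i) t}

/-- A planar substitution rule with `n` prototiles: a group `E` of isometries of the plane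
containing the translations, prototiles `p 0, …, p (n - 1)` no two of which are `E`-copies of each
other, a dilation factor `lam > 1`, and for each `i` a tiling `rule i` of `lam • p i`,
`E`-generated by the prototiles. -/
structure SubstitutionRule (n : ℕ) where
  E : Subgroup (Plane ≃ᵢ Plane)
  translation_mem : ∀ v : Plane, IsometryEquiv.addRight v ∈ E
  p : Fin n → Set Plane
  isTile : ∀ i, IsClosedDisk (p i)
  inequivalent : ∀ i j, IsCopy E (p i) (p j) → i = j
  lam : ℝ
  one_lt_lam : 1 < lam
  rule : Fin n → Set (Set Plane)
  rule_mem : ∀ i, rule i ∈ generatedTilings E p (lam • p i)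

namespace SubstitutionRule

variable {n : ℕ} (S : SubstitutionRule n)

/-- The substitution matrix: the entry `(i, j)` is the number of `E`-copies of `p i` in the
tiling `rule j` of `lam • p j`. -/
def matrix : Matrix (Fin n) (Fin n) ℕ :=
  Matrix.of fun i j => {t ∈ S.rule j | IsCopy S.E (S.p i) t}.ncard

/-- `T` is obtained from `T'` by dilating by `lam` and subdividing each dilated tile according to
the substitution rule: every dilated tile `lam • t`, `t ∈ T'`, is written as `g (lam • p i)` with
`g ∈ E` and is replaced by the tiles `g s`, `s ∈ rule i`.

The index `i` is determined by `t`.  If each `rule i` is invariant under the symmetries of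
`lam • p i` in `E`, the result does not depend on `g`, so `T` is uniquely determined by `T'` and
this relation is the graph of the substitution map.  Otherwise `g` may be chosen freely for each
tile. -/
def IsSubdivision (T' T : Set (Set Plane)) : Prop :=
  ∃ (idx : Set Plane → Fin n) (g : Set Plane → (Plane ≃ᵢ Plane)),
    (∀ t ∈ T', g t ∈ S.E ∧ g t '' (S.lam • S.p (idx t)) = S.lam • t) ∧
    T = ⋃ t ∈ T', (fun s : Set Plane => g t '' s) '' S.rule (idx t)

/-- The image, under the `k`-th iterate of the substitution map, of the set of all tilings of the
plane that are `E`-generated by the prototiles. -/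
def iterImage : ℕ → Set (Set (Set Plane))
  | 0 => generatedTilings S.E S.p Set.univ
  | k + 1 => {T | ∃ T' ∈ iterImage k, S.IsSubdivision T' T}

/-- The set of admissible tilings. -/
def admissible : Set (Set (Set Plane)) := ⋂ k, S.iterImage k

end SubstitutionRule

/-- A Jordan curve in the plane: an injective continuous image of the circle. -/
def IsJordanCurve (Γ : Set Plane) : Prop :=
  ∃ γ : Circle → Plane, Continuous γ ∧ Function.Injective γ ∧ Set.range γ = Γ

/-- `Γ` is a Jordan curve bounding the topological closed disk `Δ`. -/
def Bounds (Γ Δ : Set Plane) : Prop :=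
  IsJordanCurve Γ ∧ IsClosedDisk Δ ∧ frontier Δ = Γ

/-- The tiles of `T` that intersect `Γ`. -/
def tilesMeeting (Γ : Set Plane) (T : Set (Set Plane)) : Set (Set Plane) :=
  {t ∈ T | (t ∩ Γ).Nonempty}

/-- The tiles of `T` included in `Δ`. -/
def tilesIn (Δ : Set Plane) (T : Set (Set Plane)) : Set (Set Plane) :=
  {t ∈ T | t ⊆ Δ}

/-- The number of tiles of `T` that intersect `Γ`. -/
def countMeeting (Γ : Set Plane) (T : Set (Set Plane)) : ℕ := (tilesMeeting Γ T).ncard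

/-- The number of tiles of `T` included in `Δ`. -/
def countIn (Δ : Set Plane) (T : Set (Set Plane)) : ℕ := (tilesIn Δ T).ncard

/-- The number of tiles of `T` that are included in `Δ` and are `E`-copies of `p`. -/
def countCopiesIn (E : Subgroup (Plane ≃ᵢ Plane)) (Δ : Set Plane) (T : Set (Set Plane))
    (p : Set Plane) : ℕ := {t ∈ tilesIn Δ T | IsCopy E p t}.ncard

section Spectrum

variable {n : ℕ} (M : Matrix (Fin n) (Fin n) ℕ)

/-- `M` regarded as an endomorphism of `ℂⁿ`. -/
def complexEnd : Module.End ℂ (Fin n → ℂ) :=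
  Matrix.toLin' (M.map (Nat.cast : ℕ → ℂ))

/-- The Perron eigenvalue of `M`: its largest real eigenvalue. -/
def perronEigenvalue : ℝ := sSup {x : ℝ | (complexEnd M).HasEigenvalue (x : ℂ)}

/-- The second largest modulus `r(M)` of an eigenvalue: the maximum of the moduli of the complex
eigenvalues other than the Perron eigenvalue (and `0` if there are none). -/
def secondModulus : ℝ :=
  sSup {x : ℝ | ∃ η : ℂ, (complexEnd M).HasEigenvalue η ∧ η ≠ (perronEigenvalue M : ℂ) ∧ x = ‖η‖}

/-- `η` is semi-simple: its algebraic multiplicity (as a root of the characteristic polynomial)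
and its geometric multiplicity (the dimension of the eigenspace) coincide. -/
def IsSemisimpleEigenvalue (η : ℂ) : Prop :=
  (complexEnd M).charpoly.rootMultiplicity η =
    Module.finrank ℂ ((complexEnd M).eigenspace η)

end Spectrum

end

/-!
Write `T = T₀` as the subdivision of a tiling `T₁`, this one as the subdivision of `T₂`, and so on;
the dilated tiles of `T_k` are the supertiles of level `k`. Let `a_k` be the vector of type counts
of the level `k` supertiles inside `Δ`. The children of the supertiles of level `k + 1` inside `Δ`
contribute `M a_{k+1}` to `a_k`; every other supertile of level `k` inside `Δ` has a parent which is
connected and meets both `Δ` and its complement, hence meets `Γ`. So `a_k = M a_{k+1} + b_k` with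
`|b_k|` bounded by a constant times the number `L_{k+1}` of supertiles of level `k + 1` meeting
`Γ` (`SubstitutionRule.exists_countCopiesIn_eq`), and `a_0 = ∑ M ^ k b_k`, a finite sum as `Δ` is
bounded.

Two estimates control this sum. By Perron–Frobenius theory, if `ν` is the normalized Perron vector
of `M`, the deviation of the columns of `M ^ k` from the proportions `ν` is `O(ρ ^ k)` for every
`ρ` exceeding the moduli of the other eigenvalues, and also for `ρ` equal to the largest of them if
the eigenvalues of that modulus are semi-simple (`exists_frequencies`). On the other hand, when
there is a supertile of level `k` inside `Δ`, the curve `Γ` has diameter at least of the order of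
`lam ^ k`, so that near each supertile of level `k + 1` meeting `Γ` it crosses at least of the order
of `lam ^ k` tiles of `T`. This gives `L_{k+1} = O(L / lam ^ k)` and `lam ^ k = O(L)`, where `L`
is the number of tiles of `T` meeting `Γ` (`exists_countMeeting_mul_le`). Hence the discrepancy is
`O(L ∑ (ρ / lam) ^ k)`, the sum being over `k` with `lam ^ k = O(L)`
(`SubstitutionRule.exists_discrepancy_le`). It is a geometric sum if `ρ < lam`, and has `O(log L)`
terms, each equal to `1`, if `ρ = lam`.

Below no tiling is dilated: instead of the supertiles of level `k` and the sets `Γ`, `Δ`,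
one considers the tiles of `T_k` and the contracted sets `lam⁻¹ ^ k • Γ`, `lam⁻¹ ^ k • Δ`.

Some plane topology is needed. That the counts are finite rests on comparing areas, hence on the
fact that a closed disk has nonempty interior. In the logarithmic case with `L = 1`, the
right-hand side vanishes and one needs that a curve meeting a single tile encloses no tile, hence
that a closed disk does not separate the plane. Both facts are obtained from the nonexistence of a
continuous logarithm of an odd function on a circle (`no_log_of_odd`).
-/

/-! ### Plane topology: closed disks -/

/-- On a simply connected space, a continuous nonvanishing complex function has a logarithm. -/
theorem exists_continuous_log {A : Type*} [TopologicalSpace A] [SimplyConnectedSpace A]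
    [LocallyPathConnectedSpace A] {f : A → ℂ} (hf : Continuous f) (h0 : ∀ x, f x ≠ 0) :
    ∃ L : A → ℂ, Continuous L ∧ ∀ x, Complex.exp (L x) = f x := by
  obtain ⟨a⟩ : Nonempty A := inferInstance
  obtain ⟨F, ⟨-, hF⟩, -⟩ := Complex.isCoveringMapOn_exp.existsUnique_continuousMap_lifts
    ⟨f, hf⟩ (a₀ := a) (e₀ := Complex.log (f a)) (Complex.exp_log (h0 a)) (by simpa using h0)
  exact ⟨F, F.continuous, fun x => congrFun hF x⟩

/-- Having a continuous logarithm is invariant under homotopies through nonvanishing functions. -/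
theorem exists_log_of_homotopy {A : Type*} [TopologicalSpace A]
    {H : unitInterval × A → ℂ} (hH : Continuous H) (h0 : ∀ x, H x ≠ 0)
    {L : A → ℂ} (hL : Continuous L) (hL' : ∀ a, Complex.exp (L a) = H (0, a)) :
    ∃ L₁ : A → ℂ, Continuous L₁ ∧ ∀ a, Complex.exp (L₁ a) = H (1, a) := by
  let H' : C(unitInterval × A, {z : ℂ // z ≠ 0}) := ⟨fun x => ⟨H x, h0 x⟩, by fun_prop⟩
  have h00 : ∀ a, H' (0, a) = (fun z : ℂ ↦ (⟨_, z.exp_ne_zero⟩ : {z : ℂ // z ≠ 0}))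
      ((⟨L, hL⟩ : C(A, ℂ)) a) := fun a => Subtype.ext (hL' a).symm
  let G := Complex.isCoveringMap_exp.liftHomotopy H' ⟨L, hL⟩ h00
  refine ⟨fun a => G (1, a), by fun_prop, fun a => ?_⟩
  have := congrFun (Complex.isCoveringMap_exp.liftHomotopy_lifts H' ⟨L, hL⟩ h00) (1, a)
  exact congrArg Subtype.val this

theorem one_lt_rank_plane : 1 < Module.rank ℝ Plane := by
  rw [← Module.finrank_eq_rank]; simp

/-- An odd nonvanishing function on a circle has no continuous logarithm: the difference
`L (-z) - L z` would be a constant which is both odd and nonzero. -/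
theorem no_log_of_odd {r : ℝ} (hr : 0 ≤ r) {L : Metric.sphere (0 : Plane) r → ℂ}
    (hL : Continuous L) (hodd : ∀ z, Complex.exp (L (-z)) = - Complex.exp (L z)) : False := by
  have : PreconnectedSpace (Metric.sphere (0 : Plane) r) :=
    isPreconnected_iff_preconnectedSpace.1 (isPreconnected_sphere one_lt_rank_plane 0 r)
  obtain ⟨x, hx⟩ : (Metric.sphere (0 : Plane) r).Nonempty := NormedSpace.sphere_nonempty.2 hr
  let z₀ : Metric.sphere (0 : Plane) r := ⟨x, hx⟩
  let c : Metric.sphere (0 : Plane) r → ℂ := fun z => L (-z) - L z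
  have hc : Continuous c := by fun_prop
  have hexp : ∀ z, Complex.exp (c z) = -1 := fun z => by
    simp only [c]
    rw [Complex.exp_sub, hodd, neg_div, div_self (Complex.exp_ne_zero _)]
  have hconst : c = fun _ => c z₀ := by
    refine Complex.isCoveringMap_exp.eq_of_comp_eq hc continuous_const ?_ z₀ rfl
    funext z
    exact Subtype.ext ((hexp z).trans (hexp z₀).symm)
  have h1 : c (-z₀) = c z₀ := congrFun hconst _
  have h2 : c z₀ = 0 := by
    have : c (-z₀) = - c z₀ := by simp [c]
    rw [this] at h1
    exact self_eq_neg.1 h1.symm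
  have := hexp z₀
  rw [h2, Complex.exp_zero] at this
  norm_num at this

/-- The radial retraction of the plane onto the closed unit disk. -/
noncomputable def radialRetraction (x : Plane) : Plane := (max 1 ‖x‖)⁻¹ • x

theorem continuous_radialRetraction : Continuous radialRetraction := by
  unfold radialRetraction
  refine Continuous.smul (Continuous.inv₀ (continuous_const.max continuous_norm) fun x => ?_)
    continuous_id
  positivity

theorem radialRetraction_mem (x : Plane) : radialRetraction x ∈ Metric.closedBall (0 : Plane) 1 := by
  rw [mem_closedBall_zero_iff, radialRetraction, norm_smul, norm_inv, Real.norm_of_nonneg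
    (by positivity), inv_mul_le_iff₀ (by positivity), mul_one]
  exact le_max_right _ _

theorem radialRetraction_of_mem {x : Plane} (hx : x ∈ Metric.closedBall (0 : Plane) 1) :
    radialRetraction x = x := by
  rw [mem_closedBall_zero_iff] at hx
  simp [radialRetraction, max_eq_left hx]

/-- Invariance of domain for the plane, at the centre of a disk. -/
theorem mem_interior_image_closedBall {f : Plane → ℂ} (hf : Continuous f)
    (hinj : Set.InjOn f (Metric.closedBall 0 1)) :
    f 0 ∈ interior (f '' Metric.closedBall 0 1) := by
  by_contra hnot
  have hS : IsCompact (Metric.sphere (0 : Plane) 1) := isCompact_sphere _ _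
  have hSne : (Metric.sphere (0 : Plane) 1).Nonempty := NormedSpace.sphere_nonempty.2 zero_le_one
  obtain ⟨z₁, hz₁, hmin⟩ := hS.exists_isMinOn hSne
    (f := fun z => ‖f z - f 0‖) (by fun_prop)
  have hne : ∀ z ∈ Metric.sphere (0 : Plane) 1, f z - f 0 ≠ 0 := by
    intro z hz h
    have := hinj (Metric.sphere_subset_closedBall hz) (by simp) (sub_eq_zero.1 h)
    rw [this] at hz
    simp at hz
  have hr : 0 < ‖f z₁ - f 0‖ := norm_pos_iff.2 (hne z₁ hz₁)
  obtain ⟨b, hb, hb'⟩ : ∃ b ∈ Metric.ball (f 0) ‖f z₁ - f 0‖, b ∉ f '' Metric.closedBall 0 1 := by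
    by_contra! hcon
    exact hnot (mem_interior.2 ⟨_, hcon, Metric.isOpen_ball, Metric.mem_ball_self hr⟩)
  obtain ⟨L, hLc, hL⟩ := exists_continuous_log
    (f := fun x => f (radialRetraction x) - b)
    ((hf.comp continuous_radialRetraction).sub continuous_const)
    (fun x h => hb' ⟨_, radialRetraction_mem x, sub_eq_zero.1 h⟩)
  -- On the unit circle, `f - b` and `f - f 0` differ by a factor close to `1`.
  have hslit : ∀ z : Metric.sphere (0 : Plane) 1, (f z - b) / (f z - f 0) ∈ Complex.slitPlane := by
    intro z
    have h1 := hne z z.2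
    have : (f z - b) / (f z - f 0) = 1 + (f 0 - b) / (f z - f 0) := by
      field_simp; ring
    rw [this]
    apply Complex.mem_slitPlane_of_norm_lt_one
    rw [norm_div, div_lt_one (norm_pos_iff.2 h1)]
    refine lt_of_lt_of_le ?_ (hmin z.2)
    rw [← dist_eq_norm, dist_comm]
    exact hb
  let L₀ : Metric.sphere (0 : Plane) 1 → ℂ :=
    fun z => L z - Complex.log ((f z - b) / (f z - f 0))
  have hL₀c : Continuous L₀ := by
    refine (hLc.comp continuous_subtype_val).sub (Continuous.clog ?_ hslit)
    exact Continuous.div (by fun_prop) (by fun_prop) (fun z => hne z z.2)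
  have hL₀ : ∀ z, Complex.exp (L₀ z) = f z - f 0 := by
    intro z
    have hb0 : f z - b ≠ 0 := fun h =>
      hb' ⟨z, Metric.sphere_subset_closedBall z.2, sub_eq_zero.1 h⟩
    simp only [L₀]
    rw [Complex.exp_sub, hL, Complex.exp_log (div_ne_zero hb0 (hne z z.2)),
      radialRetraction_of_mem (Metric.sphere_subset_closedBall z.2)]
    field_simp
  -- Borsuk's homotopy from `f - f 0` to an odd map.
  let H : unitInterval × Metric.sphere (0 : Plane) 1 → ℂ := fun x =>
    f ((1 + (x.1 : ℝ))⁻¹ • (x.2 : Plane)) - f (-((x.1 : ℝ) * (1 + (x.1 : ℝ))⁻¹) • (x.2 : Plane))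
  have hpos : ∀ x : unitInterval, (0 : ℝ) < 1 + (x : ℝ) := fun x => by
    have := x.2.1; linarith
  have hHc : Continuous H := by
    have h1 : Continuous fun x : unitInterval × Metric.sphere (0 : Plane) 1 =>
      (1 + (x.1 : ℝ))⁻¹ := Continuous.inv₀ (by fun_prop) fun x => (hpos x.1).ne'
    fun_prop
  have hH0 : ∀ x, H x ≠ 0 := by
    rintro ⟨t, z⟩ h
    have ht0 := t.2.1
    have ht1 := t.2.2
    have hz : ‖(z : Plane)‖ = 1 := by simp
    have hp := hpos t
    have key := hinj (x₁ := (1 + (t : ℝ))⁻¹ • (z : Plane))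
      (x₂ := -((t : ℝ) * (1 + (t : ℝ))⁻¹) • (z : Plane)) ?_ ?_ (sub_eq_zero.1 h)
    · rw [← sub_eq_zero, ← sub_smul] at key
      have : (1 + (t : ℝ))⁻¹ - -((t : ℝ) * (1 + (t : ℝ))⁻¹) = 1 := by field_simp; ring
      rw [this, one_smul] at key
      rw [key] at hz; simp at hz
    · rw [mem_closedBall_zero_iff, norm_smul, hz, mul_one, norm_inv, Real.norm_of_nonneg hp.le]
      exact inv_le_one_of_one_le₀ (by linarith)
    · rw [mem_closedBall_zero_iff, norm_smul, hz, mul_one, norm_neg,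
        Real.norm_of_nonneg (by positivity), ← div_eq_mul_inv, div_le_one hp]
      linarith
  obtain ⟨L₁, hL₁c, hL₁⟩ := exists_log_of_homotopy hHc hH0 hL₀c (by
    intro z; rw [hL₀]; simp [H])
  refine no_log_of_odd zero_le_one hL₁c fun z => ?_
  rw [hL₁, hL₁]
  simp only [H]
  norm_num

/-- A linear isometry of the Euclidean plane with the complex numbers. -/
noncomputable def planeEquivComplex : Plane ≃ₗᵢ[ℝ] ℂ := Complex.orthonormalBasisOneI.repr.symm

namespace IsClosedDisk

variable {t : Set Plane}

/-- A closed disk is the image of the unit disk under a continuous map of the plane, injective on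
the unit disk and mapping the plane to the closed disk. -/
theorem exists_param (ht : IsClosedDisk t) : ∃ f : Plane → Plane, Continuous f ∧
    Set.InjOn f (Metric.closedBall 0 1) ∧ f '' Metric.closedBall 0 1 = t ∧
    ∃ g : t → Plane, Continuous g ∧ ∀ x : t, g x ∈ Metric.closedBall 0 1 ∧ f (g x) = x := by
  obtain ⟨h⟩ := ht
  refine ⟨fun x => h.symm ⟨radialRetraction x, radialRetraction_mem x⟩, ?_, ?_, ?_, ?_⟩
  · exact continuous_subtype_val.comp (h.symm.continuous.comp
      (continuous_radialRetraction.subtype_mk _))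
  · intro x hx y hy hxy
    have := h.symm.injective (Subtype.ext hxy)
    have := congrArg Subtype.val this
    simpa [radialRetraction_of_mem hx, radialRetraction_of_mem hy] using this
  · ext y
    constructor
    · rintro ⟨x, -, rfl⟩
      exact Subtype.property _
    · intro hy
      refine ⟨h ⟨y, hy⟩, Subtype.property _, ?_⟩
      simp [radialRetraction_of_mem (Subtype.property (h ⟨y, hy⟩))]
  · refine ⟨fun x => h x, by fun_prop, fun x => ⟨Subtype.property _, ?_⟩⟩
    simp [radialRetraction_of_mem (Subtype.property (h x))]

theorem isCompact (ht : IsClosedDisk t) : IsCompact t := by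
  obtain ⟨f, hf, -, rfl, -⟩ := ht.exists_param
  exact (isCompact_closedBall _ _).image hf

theorem nonempty (ht : IsClosedDisk t) : t.Nonempty := by
  obtain ⟨f, hf, -, rfl, -⟩ := ht.exists_param
  exact (Metric.nonempty_closedBall.2 zero_le_one).image f

theorem isPreconnected (ht : IsClosedDisk t) : IsPreconnected t := by
  obtain ⟨f, hf, -, rfl, -⟩ := ht.exists_param
  exact (convex_closedBall _ _).isPreconnected.image f hf.continuousOn

theorem interior_nonempty (ht : IsClosedDisk t) : (interior t).Nonempty := by
  obtain ⟨f, hf, hinj, rfl, -⟩ := ht.exists_param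
  have := mem_interior_image_closedBall (f := planeEquivComplex ∘ f)
    (planeEquivComplex.continuous.comp hf) (planeEquivComplex.injective.comp_injOn hinj)
  rw [Set.image_comp] at this
  have h2 : interior (planeEquivComplex '' (f '' Metric.closedBall 0 1)) =
      planeEquivComplex '' interior (f '' Metric.closedBall 0 1) :=
    (planeEquivComplex.toHomeomorph.image_interior _).symm
  rw [h2] at this
  exact (Set.Nonempty.of_image ⟨_, this⟩)

/-- A closed disk does not separate the plane: a bounded set whose frontier lies in a closed disk
is contained in this closed disk.  If `a` were a missing point of the set `D`, a logarithm of
`z - a` on the disk would extend to `D`, giving a nonvanishing function on the plane which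
agrees with `z - a` far away. -/
theorem subset_of_frontier_subset (ht : IsClosedDisk t) {D : Set Plane}
    (hD : IsCompact D) (hfr : frontier D ⊆ t) : D ⊆ t := by
  intro a ha
  by_contra hat
  obtain ⟨f, hf, hinj, hft, g, hg, hfg⟩ := ht.exists_param
  have hmem : ∀ x, f x ∈ t → f x ≠ a := fun x hx h => hat (h ▸ hx)
  obtain ⟨L, hLc, hL⟩ := exists_continuous_log
    (f := fun x => planeEquivComplex (f (radialRetraction x) - a))
    (planeEquivComplex.continuous.comp
      ((hf.comp continuous_radialRetraction).sub continuous_const))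
    (fun x h => by
      rw [map_eq_zero_iff _ planeEquivComplex.injective, sub_eq_zero] at h
      exact hmem _ (hft ▸ ⟨_, radialRetraction_mem x, rfl⟩) h)
  let ℓ : C(t, ℂ) := ⟨fun x => L (g x), hLc.comp hg⟩
  have hℓ : ∀ x : t, Complex.exp (ℓ x) = planeEquivComplex ((x : Plane) - a) := fun x => by
    change Complex.exp (L (g x)) = _
    rw [hL, radialRetraction_of_mem (hfg x).1, (hfg x).2]
  obtain ⟨G, hG⟩ := ContinuousMap.exists_extension (Y := ℂ)
    ht.isCompact.isClosed.isClosedEmbedding_subtypeVal ℓ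
  classical
  let F : Plane → ℂ := fun x => if x ∈ D then Complex.exp (G x) else planeEquivComplex (x - a)
  have hF : Continuous F := by
    refine Continuous.if (fun x hx => ?_) (Complex.continuous_exp.comp G.continuous)
      (planeEquivComplex.continuous.comp (by fun_prop))
    have := congrArg (fun k : C(t, ℂ) => k ⟨x, hfr hx⟩) hG
    rw [← hℓ ⟨x, hfr hx⟩, ← this]
    rfl
  have hF0 : ∀ x, F x ≠ 0 := by
    intro x
    by_cases hx : x ∈ D
    · simp [F, hx]
    · simp only [F, hx, if_false]
      rw [Ne, map_eq_zero_iff _ planeEquivComplex.injective, sub_eq_zero]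
      rintro rfl
      exact hx ha
  obtain ⟨Λ, hΛc, hΛ⟩ := exists_continuous_log hF hF0
  obtain ⟨R, hR⟩ := hD.isBounded.subset_closedBall a
  have hR0 : 0 ≤ R := by simpa using dist_nonneg.trans (hR ha)
  have hout : ∀ z ∈ Metric.sphere (0 : Plane) (R + 1), F (a + z) = planeEquivComplex z := by
    intro z hz
    have : a + z ∉ D := fun h => by
      have h1 := hR h
      rw [mem_closedBall_iff_norm, add_sub_cancel_left] at h1
      rw [mem_sphere_zero_iff_norm] at hz
      linarith
    simp [F, this]
  refine no_log_of_odd (r := R + 1) (by linarith)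
    (L := fun z => Λ (a + z)) (by fun_prop) fun z => ?_
  rw [hΛ, hΛ, hout _ z.2, hout _ (-z).2]
  simp

end IsClosedDisk

/-! ### Perron–Frobenius theory of primitive matrices -/

section Perron

open Matrix Finset

variable {n : ℕ} {A : Matrix (Fin n) (Fin n) ℝ}

theorem mulVec_pos_of_pos {B : Matrix (Fin n) (Fin n) ℝ} (hB : ∀ i j, 0 < B i j)
    {x : Fin n → ℝ} (hx : ∀ i, 0 ≤ x i) (hx0 : x ≠ 0) (i : Fin n) : 0 < (B *ᵥ x) i := by
  obtain ⟨j, hj⟩ := Function.ne_iff.1 hx0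
  exact Finset.sum_pos' (fun l _ => mul_nonneg (hB i l).le (hx l))
    ⟨j, mem_univ j, mul_pos (hB i j) (lt_of_le_of_ne (hx j) (Ne.symm hj))⟩

/-- A vector `x ≥ 0` in the standard simplex maximizing the Collatz–Wielandt number, that is, the
largest `t` such that `t • x ≤ A *ᵥ x`, is an eigenvector: otherwise applying a positive power of
`A` would make the inequality strict. -/
theorem exists_perron_vector [NeZero n] (hA : A.IsPrimitive) :
    ∃ (v : Fin n → ℝ) (t : ℝ), (∀ i, 0 < v i) ∧ ∑ i, v i = 1 ∧ 0 < t ∧ A *ᵥ v = t • v := by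
  obtain ⟨k, -, hk⟩ := hA.exists_pos_pow
  let Q : Set ((Fin n → ℝ) × ℝ) := (stdSimplex ℝ (Fin n) ×ˢ Set.Icc 0 (∑ i, ∑ j, A i j)) ∩
    {y | ∀ i, y.2 * y.1 i ≤ (A *ᵥ y.1) i}
  have hQ : IsCompact Q := by
    refine ((isCompact_stdSimplex ℝ (Fin n)).prod isCompact_Icc).inter_right ?_
    simp only [Set.ofPred_forall]
    refine isClosed_iInter fun i => isClosed_le (by fun_prop) ?_
    simp only [mulVec, dotProduct]
    fun_prop
  have hsum : 0 ≤ ∑ i, ∑ j, A i j := sum_nonneg fun i _ => sum_nonneg fun j _ => hA.nonneg i j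
  have hQne : Q.Nonempty := by
    refine ⟨(Pi.single 0 1, 0), ⟨single_mem_stdSimplex ℝ 0, le_rfl, hsum⟩, fun i => ?_⟩
    simp [hA.nonneg]
  -- the bound on `t` in the definition of `Q` is automatic
  have hmemQ : ∀ (x : Fin n → ℝ) (t : ℝ), (∀ i, 0 ≤ x i) → ∑ i, x i = 1 → 0 ≤ t →
      (∀ i, t * x i ≤ (A *ᵥ x) i) → (x, t) ∈ Q := by
    intro x t hx hx1 ht h
    refine ⟨⟨⟨hx, hx1⟩, ht, ?_⟩, h⟩
    calc t = ∑ i, t * x i := by rw [← mul_sum, hx1, mul_one]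
      _ ≤ ∑ i, (A *ᵥ x) i := sum_le_sum fun i _ => h i
      _ ≤ ∑ i, ∑ j, A i j := by
        refine sum_le_sum fun i _ => ?_
        simp only [mulVec, dotProduct]
        refine sum_le_sum fun j _ => ?_
        refine mul_le_of_le_one_right (hA.nonneg i j) ?_
        rw [← hx1]
        exact single_le_sum (fun l _ => hx l) (mem_univ j)
  obtain ⟨⟨v, t⟩, ⟨⟨⟨hv0, hv1⟩, ht0, -⟩, hvt⟩, hmax⟩ :=
    hQ.exists_isMaxOn hQne (f := Prod.snd) (by fun_prop)
  have hvne : v ≠ 0 := by rintro rfl; simp at hv1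
  have heig : A *ᵥ v = t • v := by
    by_contra hne
    let y := (A ^ k) *ᵥ v
    have hy : ∀ i, 0 < y i := mulVec_pos_of_pos hk hv0 hvne
    have hz : ∀ i, 0 < ((A ^ k) *ᵥ (A *ᵥ v - t • v)) i :=
      mulVec_pos_of_pos hk (fun i => by simpa using hvt i) (sub_ne_zero.2 hne)
    have hz' : (A ^ k) *ᵥ (A *ᵥ v - t • v) = A *ᵥ y - t • y := by
      simp only [y]
      rw [mulVec_sub, mulVec_mulVec, mulVec_mulVec, mulVec_smul, ← pow_succ, ← pow_succ']
    rw [hz'] at hz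
    obtain ⟨ε, hε, hεy⟩ : ∃ ε > 0, ∀ i, (t + ε) * y i ≤ (A *ᵥ y) i := by
      obtain ⟨i₀, -, hi₀⟩ := exists_min_image univ (fun i => (A *ᵥ y - t • y) i / y i)
        univ_nonempty
      refine ⟨_, div_pos (hz i₀) (hy i₀), fun i => ?_⟩
      have h1 := (le_div_iff₀ (hy i)).1 (hi₀ i (mem_univ i))
      rw [add_mul]
      have h2 : (A *ᵥ y - t • y) i = (A *ᵥ y) i - t * y i := rfl
      linarith
    have hs : 0 < ∑ i, y i := sum_pos (fun i _ => hy i) univ_nonempty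
    have := hmax (hmemQ ((∑ i, y i)⁻¹ • y) (t + ε) (fun i => ?_) ?_ (by linarith) fun i => ?_)
    · simp only [Set.mem_ofPred_eq] at this
      linarith
    · exact mul_nonneg (inv_nonneg.2 hs.le) (hy i).le
    · simp only [Pi.smul_apply, smul_eq_mul, ← mul_sum]
      exact inv_mul_cancel₀ hs.ne'
    · rw [mulVec_smul]
      simp only [Pi.smul_apply, smul_eq_mul]
      calc (t + ε) * ((∑ i, y i)⁻¹ * y i) = (∑ i, y i)⁻¹ * ((t + ε) * y i) := by ring
        _ ≤ _ := by gcongr; exact hεy i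
  have hpow : ∀ m, (A ^ m) *ᵥ v = t ^ m • v := by
    intro m
    induction m with
    | zero => simp
    | succ m ih => rw [pow_succ, ← mulVec_mulVec, heig, mulVec_smul, ih, smul_smul, pow_succ']
  have hpos : ∀ i, 0 < t ^ k * v i := fun i => by
    have := mulVec_pos_of_pos hk hv0 hvne i
    rwa [hpow k] at this
  have hv : ∀ i, 0 < v i := fun i => pos_of_mul_pos_right (hpos i) (pow_nonneg ht0 k)
  have ht : 0 < t := by
    have hAv : A *ᵥ v ≠ 0 := by
      intro h0
      obtain ⟨k, hk0, hk⟩ := hA.exists_pos_pow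
      have h2 := mulVec_pos_of_pos hk hv0 hvne 0
      obtain ⟨m, rfl⟩ := Nat.exists_eq_succ_of_ne_zero hk0.ne'
      rw [Nat.succ_eq_add_one, pow_succ, ← mulVec_mulVec, h0] at h2
      simp at h2
    refine lt_of_le_of_ne ht0 fun h => hAv ?_
    rw [heig, ← h, zero_smul]
  exact ⟨v, t, hv, hv1, ht, heig⟩

theorem isPrimitive_transpose (hA : A.IsPrimitive) : Aᵀ.IsPrimitive := by
  obtain ⟨k, hk0, hk⟩ := hA.exists_pos_pow
  exact ⟨fun i j => hA.nonneg j i, k, hk0, fun i j => by rw [← transpose_pow]; exact hk j i⟩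

/-- The eigenspace of a primitive matrix for its Perron eigenvalue is a line. -/
theorem eq_smul_of_mulVec_eq [NeZero n] (hA : A.IsPrimitive) {v : Fin n → ℝ} {t : ℝ}
    (hv : ∀ i, 0 < v i) (hAv : A *ᵥ v = t • v) {w : Fin n → ℝ} (hw : A *ᵥ w = t • w) :
    ∃ c : ℝ, w = c • v := by
  obtain ⟨k, -, hk⟩ := hA.exists_pos_pow
  obtain ⟨i₀, -, hi₀⟩ := exists_min_image univ (fun i => w i / v i) univ_nonempty
  refine ⟨w i₀ / v i₀, ?_⟩
  by_contra hne
  set c := w i₀ / v i₀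
  have hz : A *ᵥ (w - c • v) = t • (w - c • v) := by
    rw [mulVec_sub, mulVec_smul, hw, hAv, smul_sub, smul_comm]
  have hpow : ∀ m, (A ^ m) *ᵥ (w - c • v) = t ^ m • (w - c • v) := by
    intro m
    induction m with
    | zero => simp
    | succ m ih => rw [pow_succ, ← mulVec_mulVec, hz, mulVec_smul, ih, smul_smul, pow_succ']
  have h1 : ∀ i, 0 ≤ (w - c • v) i := fun i => by
    have := (le_div_iff₀ (hv i)).1 (hi₀ i (mem_univ i))
    simpa using this
  have h2 := mulVec_pos_of_pos hk h1 (sub_ne_zero.2 hne) i₀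
  rw [hpow k] at h2
  have h3 : (w - c • v) i₀ = 0 := by
    simp [c, (hv i₀).ne']
  simp only [Pi.smul_apply, h3, smul_zero, lt_irrefl] at h2

end Perron

/-! ### Growth of the powers of an endomorphism -/

section Growth

variable {V : Type*} [NormedAddCommGroup V] [NormedSpace ℂ V]

/-- On a generalized eigenvector for `η`, the powers of `f` grow more slowly than `ρ ^ k` for each
`ρ > ‖η‖`: the polynomial factor is absorbed by the gap `ρ - ‖η‖`. -/
theorem exists_norm_pow_le_of_pow_eq_zero (f : Module.End ℂ V) {η : ℂ} {ρ : ℝ} (hη : ‖η‖ < ρ)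
    (m : ℕ) (x : V) (hx : ((f - algebraMap ℂ _ η) ^ m) x = 0) :
    ∃ C : ℝ, ∀ k, ‖(f ^ k) x‖ ≤ C * ρ ^ k := by
  have hρ : 0 < ρ := (norm_nonneg _).trans_lt hη
  induction m generalizing x with
  | zero => exact ⟨0, fun k => by simp at hx; simp [hx]⟩
  | succ m ih =>
    rw [pow_succ, Module.End.mul_apply] at hx
    obtain ⟨C, hC⟩ := ih _ hx
    set y := (f - algebraMap ℂ (Module.End ℂ V) η) x with hy
    have hfx : f x = η • x + y := by simp [hy]
    set D := max ‖x‖ (C / (ρ - ‖η‖))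
    have hCD : C ≤ D * (ρ - ‖η‖) := (div_le_iff₀ (by linarith)).1 (le_max_right _ _)
    refine ⟨D, fun k => ?_⟩
    induction k with
    | zero => simp [D]
    | succ k ihk =>
      calc ‖(f ^ (k + 1)) x‖ = ‖η • (f ^ k) x + (f ^ k) y‖ := by
            rw [pow_succ, Module.End.mul_apply, hfx, map_add, map_smul]
        _ ≤ ‖η‖ * ‖(f ^ k) x‖ + ‖(f ^ k) y‖ := by
            rw [← norm_smul]; exact norm_add_le _ _
        _ ≤ ‖η‖ * (D * ρ ^ k) + D * (ρ - ‖η‖) * ρ ^ k := by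
            gcongr
            exact (hC k).trans (by gcongr)
        _ = D * ρ ^ (k + 1) := by ring

end Growth

/-! ### Frequencies -/

section Frequencies

open Matrix Finset

variable {n : ℕ} (M : Matrix (Fin n) (Fin n) ℕ)

theorem complexEnd_apply (x : Fin n → ℂ) (i : Fin n) :
    complexEnd M x i = ∑ j, (M i j : ℂ) * x j := by
  simp [complexEnd, mulVec, dotProduct]

theorem complexEnd_pow_single (k : ℕ) (i j : Fin n) :
    ((complexEnd M) ^ k) (Pi.single j 1) i = ((M ^ k) i j : ℂ) := by
  rw [complexEnd, ← Matrix.toLin'_pow]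
  have : (M.map (Nat.cast : ℕ → ℂ)) ^ k = (M ^ k).map (Nat.cast : ℕ → ℂ) :=
    (map_pow (Nat.castRingHom ℂ).mapMatrix M k).symm
  simp [this]

variable {M}

/-- Every eigenvalue has modulus at most the eigenvalue of a positive left eigenvector. -/
theorem norm_eigenvalue_le {u : Fin n → ℝ} {t : ℝ} (hu : ∀ i, 0 < u i)
    (huM : ∀ j, ∑ i, u i * (M i j : ℝ) = t * u j) {η : ℂ}
    (hη : (complexEnd M).HasEigenvalue η) : ‖η‖ ≤ t := by
  obtain ⟨x, hx⟩ := hη.exists_hasEigenvector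
  have hpos : 0 < ∑ i, u i * ‖x i‖ := by
    obtain ⟨j, hj⟩ := Function.ne_iff.1 hx.2
    exact sum_pos' (fun i _ => mul_nonneg (hu i).le (norm_nonneg _))
      ⟨j, mem_univ j, mul_pos (hu j) (norm_pos_iff.2 hj)⟩
  refine le_of_mul_le_mul_right ?_ hpos
  calc ‖η‖ * ∑ i, u i * ‖x i‖ = ∑ i, u i * ‖complexEnd M x i‖ := by
        rw [mul_sum, hx.apply_eq_smul]
        refine sum_congr rfl fun i _ => ?_
        simp only [Pi.smul_apply, smul_eq_mul, norm_mul]; ring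
    _ ≤ ∑ i, u i * ∑ j, (M i j : ℝ) * ‖x j‖ := by
        gcongr with i _
        · exact (hu i).le
        rw [complexEnd_apply]
        refine (norm_sum_le _ _).trans (le_of_eq ?_)
        simp
    _ = t * ∑ i, u i * ‖x i‖ := by
        simp only [mul_sum]
        rw [sum_comm]
        refine sum_congr rfl fun j _ => ?_
        rw [← mul_assoc, ← huM, sum_mul]
        exact sum_congr rfl fun i _ => by ring

variable (M) in
/-- The frequencies of the letters are the entries of the normalized Perron vector. The deviation
from these frequencies of the column `j` of `M ^ k` is governed by the eigenvalues other than the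
Perron eigenvalue, since the Perron component of the basis vector `j` contributes nothing to it. -/
theorem exists_frequencies (hM : (M.map (Nat.cast : ℕ → ℝ)).IsPrimitive) :
    ∃ ν : Fin n → ℝ, (∀ i, 0 < ν i) ∧ ∀ ρ : ℝ, 0 < ρ →
      (secondModulus M < ρ ∨ (secondModulus M = ρ ∧ ∀ η : ℂ,
        (complexEnd M).HasEigenvalue η → ‖η‖ = ρ → IsSemisimpleEigenvalue M η)) →
      ∃ C : ℝ, 0 < C ∧ ∀ k i j,
        |((M ^ k) i j : ℝ) - ν i * ∑ l, ((M ^ k) l j : ℝ)| ≤ C * ρ ^ k := by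
  rcases Nat.eq_zero_or_pos n with rfl | hn
  · exact ⟨fun _ => 1, fun _ => one_pos, fun ρ _ _ => ⟨1, one_pos, fun k i => i.elim0⟩⟩
  have : NeZero n := ⟨hn.ne'⟩
  obtain ⟨v, t, hv, hv1, ht, hMv⟩ := exists_perron_vector hM
  obtain ⟨u, s, hu, -, hs, hMu⟩ := exists_perron_vector (isPrimitive_transpose hM)
  have hMv' : ∀ i, ∑ j, (M i j : ℝ) * v j = t * v i := fun i => congrFun hMv i
  have hMu' : ∀ j, ∑ i, u i * (M i j : ℝ) = s * u j := fun j => by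
    rw [← show _ = s * u j from congrFun hMu j]
    exact sum_congr rfl fun i _ => mul_comm _ _
  have huv : 0 < ∑ i, u i * v i := sum_pos (fun i _ => mul_pos (hu i) (hv i)) univ_nonempty
  obtain rfl : s = t := by
    refine mul_right_cancel₀ huv.ne' ?_
    calc s * ∑ j, u j * v j = ∑ j, (∑ i, u i * (M i j : ℝ)) * v j := by
          rw [mul_sum]; exact sum_congr rfl fun j _ => by rw [hMu']; ring
      _ = ∑ i, u i * ∑ j, (M i j : ℝ) * v j := by
          simp only [sum_mul, mul_sum]; rw [sum_comm]
          exact sum_congr rfl fun i _ => sum_congr rfl fun j _ => by ring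
      _ = t * ∑ j, u j * v j := by
          rw [mul_sum]; exact sum_congr rfl fun j _ => by rw [hMv']; ring
  set f := complexEnd M with hf
  let vC : Fin n → ℂ := fun i => (v i : ℂ)
  have hfv : f vC = (s : ℂ) • vC := by
    funext i
    rw [hf, complexEnd_apply]
    simp only [vC, Pi.smul_apply, smul_eq_mul]
    exact_mod_cast hMv' i
  have hline : ∀ w : Fin n → ℂ, f w = (s : ℂ) • w → ∃ c : ℂ, w = c • vC := by
    intro w hw
    have hw' : ∀ i, ∑ j, (M i j : ℂ) * w j = (s : ℂ) * w i := fun i => by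
      rw [← complexEnd_apply, ← hf, hw]; rfl
    obtain ⟨a, ha⟩ := eq_smul_of_mulVec_eq hM hv hMv (w := fun i => (w i).re) (by
      funext i
      have := congrArg Complex.re (hw' i)
      simpa [mulVec, dotProduct] using this)
    obtain ⟨b, hb⟩ := eq_smul_of_mulVec_eq hM hv hMv (w := fun i => (w i).im) (by
      funext i
      have := congrArg Complex.im (hw' i)
      simpa [mulVec, dotProduct] using this)
    refine ⟨⟨a, b⟩, funext fun i => Complex.ext ?_ ?_⟩
    · simpa [vC] using congrFun ha i
    · simpa [vC] using congrFun hb i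
  -- the Perron eigenvalue has no generalized eigenvectors other than its eigenvectors
  have hgen : ∀ (m : ℕ) (x : Fin n → ℂ), ((f - algebraMap ℂ _ (s : ℂ)) ^ m) x = 0 →
      f x = (s : ℂ) • x := by
    -- pairing an eigenvector in the range of `f - s` with the left Perron vector gives `0`
    have hsq : ∀ y, (f - algebraMap ℂ _ (s : ℂ)) ((f - algebraMap ℂ _ (s : ℂ)) y) = 0 →
        (f - algebraMap ℂ _ (s : ℂ)) y = 0 := by
      intro y hy
      set z := (f - algebraMap ℂ (Module.End ℂ (Fin n → ℂ)) (s : ℂ)) y with hz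
      obtain ⟨c, hc⟩ := hline z (by simpa [sub_eq_zero] using hy)
      have h1 : ∑ i, (u i : ℂ) * z i = 0 := by
        have : ∀ i, z i = ∑ j, (M i j : ℂ) * y j - s * y i := fun i => by
          simp [hz, hf, complexEnd_apply]
        simp only [this, mul_sub, sum_sub_distrib, mul_sum]
        rw [sum_comm, sub_eq_zero]
        refine sum_congr rfl fun j _ => ?_
        have h2 : ∑ i, (u i : ℂ) * (M i j : ℂ) = s * u j := by exact_mod_cast hMu' j
        rw [mul_left_comm, ← mul_assoc, mul_comm (s : ℂ), mul_comm _ (s : ℂ), ← h2, sum_mul]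
        exact sum_congr rfl fun i _ => by ring
      have h2 : c * ((∑ i, u i * v i : ℝ) : ℂ) = 0 := by
        rw [← h1, hc]
        push_cast
        rw [mul_sum]
        refine sum_congr rfl fun i _ => ?_
        simp only [vC, Pi.smul_apply, smul_eq_mul]; ring
      rcases mul_eq_zero.1 h2 with h | h
      · rw [hc, h, zero_smul]
      · exact absurd (Complex.ofReal_eq_zero.1 h) huv.ne'
    intro m
    induction m with
    | zero => intro x hx; simp at hx; simp [hx]
    | succ m ih =>
      intro x hx
      cases m with
      | zero => simpa [sub_eq_zero] using hx
      | succ m =>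
        refine ih x ?_
        rw [pow_succ', pow_succ', Module.End.mul_apply, Module.End.mul_apply] at hx
        rw [pow_succ', Module.End.mul_apply]
        exact hsq _ hx
  have hvC : vC ≠ 0 := fun h => (hv 0).ne' (by simpa [vC] using congrFun h 0)
  have hsE : f.HasEigenvalue (s : ℂ) :=
    Module.End.hasEigenvalue_of_hasEigenvector ⟨Module.End.mem_eigenspace_iff.2 hfv, hvC⟩
  have hperron : perronEigenvalue M = s := by
    refine IsGreatest.csSup_eq ⟨hsE, fun x hx => ?_⟩
    have := norm_eigenvalue_le hu hMu' hx
    exact (le_abs_self x).trans (by simpa using this)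
  have hsecond : ∀ η : ℂ, f.HasEigenvalue η → η ≠ s → ‖η‖ ≤ secondModulus M := by
    intro η hη hηs
    refine le_csSup ⟨s, ?_⟩ ⟨η, hη, by rwa [hperron], rfl⟩
    rintro _ ⟨η', hη', -, rfl⟩
    exact norm_eigenvalue_le hu hMu' hη'
  refine ⟨v, hv, fun ρ hρ hcase => ?_⟩
  -- decompose the vector into generalized eigenvectors
  have key : ∀ x : Fin n → ℂ, ∃ C : ℝ, ∀ k i,
      ‖(f ^ k) x i - v i * ∑ l, (f ^ k) x l‖ ≤ C * ρ ^ k := by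
    have hnorm : ∀ (x : Fin n → ℂ), (∃ C : ℝ, ∀ k, ‖(f ^ k) x‖ ≤ C * ρ ^ k) →
        ∃ C : ℝ, ∀ k i, ‖(f ^ k) x i - v i * ∑ l, (f ^ k) x l‖ ≤ C * ρ ^ k := by
      rintro x ⟨C, hC⟩
      refine ⟨(1 + n) * C, fun k i => ?_⟩
      have h1 : ‖(v i : ℂ)‖ ≤ 1 := by
        rw [Complex.norm_real, Real.norm_of_nonneg (hv i).le, ← hv1]
        exact single_le_sum (fun l _ => (hv l).le) (mem_univ i)
      calc _ ≤ ‖(f ^ k) x i‖ + ‖(v i : ℂ)‖ * ‖∑ l, (f ^ k) x l‖ := by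
            rw [← norm_mul]; exact norm_sub_le _ _
        _ ≤ ‖(f ^ k) x‖ + 1 * ∑ l : Fin n, ‖(f ^ k) x‖ := by
            gcongr
            · exact norm_le_pi_norm _ i
            · exact (norm_sum_le _ _).trans (sum_le_sum fun l _ => norm_le_pi_norm _ l)
        _ = (1 + n) * ‖(f ^ k) x‖ := by simp; ring
        _ ≤ (1 + n) * (C * ρ ^ k) := by gcongr; exact hC k
        _ = _ := by ring
    intro x
    have hx : x ∈ ⨆ η : ℂ, f.maxGenEigenspace η := by
      rw [Module.End.iSup_maxGenEigenspace_eq_top]; trivial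
    induction hx using Submodule.iSup_induction' with
    | zero => exact ⟨0, fun k i => by simp⟩
    | add x y _ _ hx hy =>
      obtain ⟨C, hC⟩ := hx
      obtain ⟨D, hD⟩ := hy
      refine ⟨C + D, fun k i => ?_⟩
      calc _ = ‖((f ^ k) x i - v i * ∑ l, (f ^ k) x l) +
            ((f ^ k) y i - v i * ∑ l, (f ^ k) y l)‖ := by
            simp only [map_add, Pi.add_apply, sum_add_distrib]; congr 1; ring
        _ ≤ _ := (norm_add_le _ _).trans (by rw [add_mul]; exact add_le_add (hC k i) (hD k i))
    | mem η x hx =>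
      obtain ⟨m, hm⟩ := Module.End.mem_maxGenEigenspace _ _ _ |>.1 hx
      rw [← Algebra.algebraMap_eq_smul_one] at hm
      by_cases hx0 : x = 0
      · exact ⟨0, fun k i => by simp [hx0]⟩
      have heig : ∀ ζ : ℂ, f x = ζ • x → ∀ k, (f ^ k) x = ζ ^ k • x := by
        intro ζ h k
        induction k with
        | zero => simp
        | succ k ih => rw [pow_succ, Module.End.mul_apply, h, map_smul, ih, smul_smul, pow_succ']
      by_cases hηs : η = s
      · rw [hηs] at hm
        obtain ⟨c, hc⟩ := hline x (hgen m x hm)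
        refine ⟨0, fun k i => ?_⟩
        have hsum : ∑ l, vC l = 1 := by
          simp only [vC]; exact_mod_cast hv1
        rw [heig _ (hgen m x hm), hc]
        simp only [Pi.smul_apply, smul_eq_mul, ← mul_sum, hsum]
        simp [vC, mul_comm, mul_left_comm]
        ring
      · have hηE : f.HasEigenvalue η := by
          refine Module.End.hasEigenvalue_of_hasGenEigenvalue (k := m) fun h => hx0 ?_
          have : x ∈ f.genEigenspace η m := by
            rw [Module.End.mem_genEigenspace_nat, LinearMap.mem_ker]
            rwa [← Algebra.algebraMap_eq_smul_one]
          rw [h] at this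
          exact (Submodule.mem_bot ℂ).1 this
        refine hnorm x ?_
        by_cases hlt : ‖η‖ < ρ
        · exact exists_norm_pow_le_of_pow_eq_zero f hlt m x hm
        · have hle := hsecond η hηE hηs
          rcases hcase with hcase | ⟨hcase, hss⟩
          · exact absurd (hle.trans_lt hcase) hlt
          · have hηρ : ‖η‖ = ρ := le_antisymm (hcase ▸ hle) (not_lt.1 hlt)
            have h1 : f.eigenspace η = f.maxGenEigenspace η := by
              refine Submodule.eq_of_le_of_finrank_eq ?_ ?_
              · exact (f.genEigenspace_le_maximal η 1)
              · rw [LinearMap.finrank_maxGenEigenspace_eq]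
                exact (hss η hηE hηρ).symm
            rw [← h1, Module.End.mem_eigenspace_iff] at hx
            exact ⟨‖x‖, fun k => by rw [heig η hx, norm_smul, norm_pow, hηρ, mul_comm]⟩
  choose C hC using fun j : Fin n => key (Pi.single j 1)
  refine ⟨∑ j, |C j| + 1, by positivity, fun k i j => ?_⟩
  have h := hC j k i
  simp only [hf, complexEnd_pow_single] at h
  have h2 : ‖(((M ^ k) i j : ℝ) : ℂ) - v i * ∑ l, (((M ^ k) l j : ℝ) : ℂ)‖ =
      |((M ^ k) i j : ℝ) - v i * ∑ l, ((M ^ k) l j : ℝ)| := by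
    rw [← Real.norm_eq_abs, ← Complex.norm_real]
    push_cast
    rfl
  rw [← h2]
  simp only [Complex.ofReal_natCast]
  refine h.trans ?_
  gcongr
  have : |C j| ≤ ∑ j, |C j| :=
    single_le_sum (f := fun j => |C j|) (fun _ _ => abs_nonneg _) (mem_univ j)
  linarith [le_abs_self (C j)]

end Frequencies

/-! ### Packings of the plane by sets of comparable size -/

/-- The members of `T` contain disks of radius `r`, have diameter at most `D`, and have pairwise
disjoint interiors. -/
structure IsPacking (r D : ℝ) (T : Set (Set Plane)) : Prop where
  exists_ball_subset : ∀ t ∈ T, ∃ z, Metric.ball z r ⊆ t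
  dist_le : ∀ t ∈ T, ∀ x ∈ t, ∀ y ∈ t, dist x y ≤ D
  disjoint : ∀ t ∈ T, ∀ t' ∈ T, t ≠ t' → Disjoint (interior t) (interior t')

namespace IsPacking

open MeasureTheory

variable {r D : ℝ} {T : Set (Set Plane)}

/-- Comparison of areas: the interiors of the members are disjoint and each has at least the area of
a disk of radius `r`. -/
theorem card_mul_sq_le (hT : IsPacking r D T) (hr : 0 < r) {x : Plane} {R : ℝ} (hR : 0 ≤ R)
    (F : Finset (Set Plane)) (hF : ∀ t ∈ F, t ∈ T ∧ t ⊆ Metric.closedBall x R) :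
    (F.card : ℝ) * r ^ 2 ≤ R ^ 2 := by
  have h1 : (volume (⋃ t ∈ F, interior t) : ENNReal) = ∑ t ∈ F, volume (interior t) :=
    measure_biUnion_finset (fun t ht t' ht' hne => hT.disjoint t (hF t ht).1 t' (hF t' ht').1 hne)
      fun t _ => isOpen_interior.measurableSet
  have h2 : volume (⋃ t ∈ F, interior t) ≤ volume (Metric.closedBall x R) :=
    measure_mono (Set.iUnion₂_subset fun t ht => interior_subset.trans (hF t ht).2)
  have h3 : ∀ t ∈ F, volume (Metric.ball (0 : Plane) r) ≤ volume (interior t) := by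
    intro t ht
    obtain ⟨z, hz⟩ := hT.exists_ball_subset t (hF t ht).1
    rw [← Measure.addHaar_ball_center volume z r]
    exact measure_mono (interior_maximal hz Metric.isOpen_ball)
  have h4 : (F.card : ENNReal) * volume (Metric.ball (0 : Plane) r) ≤
      volume (Metric.closedBall x R) := by
    refine le_trans ?_ (h1 ▸ h2)
    rw [← nsmul_eq_mul]
    exact Finset.card_nsmul_le_sum _ _ _ h3
  rw [Measure.addHaar_closedBall _ _ hR, Measure.addHaar_ball _ _ hr.le, ← mul_assoc,
    finrank_euclideanSpace_fin] at h4
  have h5 := (ENNReal.mul_le_mul_iff_left (Metric.measure_ball_pos volume (0 : Plane) one_pos).ne'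
    measure_ball_lt_top.ne).1 h4
  rw [← ENNReal.ofReal_natCast, ← ENNReal.ofReal_mul (by positivity)] at h5
  exact (ENNReal.ofReal_le_ofReal_iff (by positivity)).1 h5

theorem finite_subset_closedBall (hT : IsPacking r D T) (hr : 0 < r) (x : Plane) (R : ℝ) :
    {t ∈ T | t ⊆ Metric.closedBall x R}.Finite := by
  by_contra hinf
  obtain ⟨F, hF, hcard⟩ := Set.Infinite.exists_subset_card_eq hinf (⌊|R| ^ 2 / r ^ 2⌋₊ + 1)
  have h := hT.card_mul_sq_le hr (abs_nonneg R) F fun t ht =>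
    ⟨(hF ht).1, (hF ht).2.trans (Metric.closedBall_subset_closedBall (le_abs_self R))⟩
  rw [← le_div_iff₀ (by positivity), hcard] at h
  push_cast at h
  linarith [Nat.lt_floor_add_one (|R| ^ 2 / r ^ 2)]

theorem finite_tilesMeeting (hT : IsPacking r D T) (hr : 0 < r) {X : Set Plane}
    (hX : Bornology.IsBounded X) : (tilesMeeting X T).Finite := by
  obtain ⟨R, hR⟩ := hX.subset_closedBall 0
  refine (hT.finite_subset_closedBall hr 0 (R + D)).subset ?_
  rintro t ⟨ht, x, hxt, hxX⟩
  refine ⟨ht, fun y hy => ?_⟩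
  have h1 := hT.dist_le t ht y hy x hxt
  have h2 : dist x 0 ≤ R := hR hxX
  exact (dist_triangle y x 0).trans (by linarith)

theorem finite_tilesIn (hT : IsPacking r D T) (hr : 0 < r) {X : Set Plane}
    (hX : Bornology.IsBounded X) : (tilesIn X T).Finite := by
  obtain ⟨R, hR⟩ := hX.subset_closedBall 0
  exact (hT.finite_subset_closedBall hr 0 R).subset fun t ht => ⟨ht.1, ht.2.trans hR⟩

end IsPacking

/-- A connected set joining a point `x` to a point at distance at least `R` cannot be covered by few
sets of diameter at most `D` inside the disk of radius `R` about `x`. -/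
theorem le_card_mul_of_isPreconnected {Y : Set Plane} (hY : IsPreconnected Y) {x y : Plane}
    (hx : x ∈ Y) (hy : y ∈ Y) {R D : ℝ} (hD : 0 ≤ D) (hR : R ≤ dist x y)
    (F : Finset (Set Plane)) (hF : ∀ s ∈ F, ∀ p ∈ s, ∀ q ∈ s, dist p q ≤ D)
    (hcov : Y ∩ Metric.ball x R ⊆ ⋃ s ∈ F, s) : R ≤ F.card * D := by
  have h1 : Set.Ico 0 R ⊆ ⋃ s ∈ F, (fun p => dist p x) '' s := by
    intro ρ hρ
    obtain ⟨p, hp, hpρ⟩ := hY.intermediate_value hx hy (f := fun p => dist p x) (by fun_prop)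
      (show ρ ∈ Set.Icc (dist x x) (dist y x) by
        rw [dist_self, dist_comm]; exact ⟨hρ.1, hρ.2.le.trans hR⟩)
    have hp' : p ∈ ⋃ s ∈ F, s := hcov ⟨hp, by
      rw [Metric.mem_ball]; exact lt_of_eq_of_lt hpρ hρ.2⟩
    simp only [Set.mem_iUnion] at hp' ⊢
    obtain ⟨s, hs, hps⟩ := hp'
    exact ⟨s, hs, p, hps, hpρ⟩
  have h2 : ∀ s ∈ F, MeasureTheory.volume ((fun p => dist p x) '' s) ≤ ENNReal.ofReal D := by
    intro s hs
    refine (Real.volume_le_diam _).trans (Metric.ediam_le ?_)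
    rintro _ ⟨p, hp, rfl⟩ _ ⟨q, hq, rfl⟩
    rw [edist_dist]
    refine ENNReal.ofReal_le_ofReal ((hF s hs p hp q hq).trans' ?_)
    exact dist_dist_dist_le_left p q x
  have h3 : ENNReal.ofReal R ≤ ENNReal.ofReal (F.card * D) := by
    calc ENNReal.ofReal R = MeasureTheory.volume (Set.Ico 0 R) := by simp
      _ ≤ _ := MeasureTheory.measure_mono h1
      _ ≤ ∑ s ∈ F, MeasureTheory.volume ((fun p => dist p x) '' s) :=
        MeasureTheory.measure_biUnion_finset_le _ _
      _ ≤ ∑ s ∈ F, ENNReal.ofReal D := Finset.sum_le_sum h2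
      _ = _ := by
        rw [Finset.sum_const, nsmul_eq_mul, ENNReal.ofReal_mul (by positivity),
          ENNReal.ofReal_natCast]
  exact (ENNReal.ofReal_le_ofReal_iff (by positivity)).1 h3

/-- A connected set `X`, none of whose points is within `δ` of all the others, meets at most
`C / a` times as many members of a packing `T'` as the dilated set `a • X` meets members of a
covering packing `T`: near each member of `T'` meeting `X`, the set `a • X` must cross about `a`
members of `T`, and each member of `T` is counted boundedly often. -/
theorem exists_countMeeting_mul_le {r D δ : ℝ} (hr : 0 < r) (hD : 0 < D) (hδ : 0 < δ) :
    ∃ C : ℝ, 0 < C ∧ ∀ T T' : Set (Set Plane), IsPacking r D T → IsPacking r D T' →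
      ⋃₀ T = Set.univ → ∀ a : ℝ, 1 ≤ a → ∀ X : Set Plane, IsPreconnected X →
      Bornology.IsBounded X → (∀ x ∈ X, ∃ y ∈ X, δ ≤ dist x y) →
      (countMeeting X T' : ℝ) * a ≤ C * countMeeting (a • X) T ∧
      (X.Nonempty → a ≤ C * countMeeting (a • X) T) := by
  classical
  set N : ℝ := (D + δ + D) ^ 2 / r ^ 2 with hN
  have hN0 : 0 < N := by positivity
  refine ⟨(N + 1) * (D / δ), by positivity, fun T T' hT hT' hcov a ha X hX hXb hfar => ?_⟩
  have ha0 : 0 < a := by linarith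
  have hYb : Bornology.IsBounded (a • X) := hXb.smul₀ a
  have hfin := hT.finite_tilesMeeting hr hYb
  have hfin' := hT'.finite_tilesMeeting hr hXb
  let F := hfin.toFinset
  let F' := hfin'.toFinset
  have hFc : (countMeeting (a • X) T : ℝ) = F.card := by
    rw [countMeeting, Set.ncard_eq_toFinset_card _ hfin]
  have hFc' : (countMeeting X T' : ℝ) = F'.card := by
    rw [countMeeting, Set.ncard_eq_toFinset_card _ hfin']
  have hY : IsPreconnected (a • X) := hX.image _ (by fun_prop)
  let near : Plane → Set Plane → Prop := fun x s => (s ∩ Metric.ball (a • x) (a * δ)).Nonempty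
  have hlow : ∀ x ∈ X, a * δ ≤ (F.filter (near x)).card * D := by
    intro x hx
    obtain ⟨y, hy, hxy⟩ := hfar x hx
    refine le_card_mul_of_isPreconnected hY (Set.smul_mem_smul_set hx)
      (Set.smul_mem_smul_set hy) hD.le ?_ _ ?_ ?_
    · rw [dist_smul₀, Real.norm_of_nonneg ha0.le]; gcongr
    · intro s hs
      exact hT.dist_le s ((hfin.mem_toFinset.1 (Finset.mem_filter.1 hs).1).1)
    · rintro p ⟨hpY, hpb⟩
      have : p ∈ ⋃₀ T := hcov ▸ Set.mem_univ p
      obtain ⟨s, hs, hps⟩ := this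
      simp only [Set.mem_iUnion]
      exact ⟨s, Finset.mem_filter.2 ⟨hfin.mem_toFinset.2 ⟨hs, p, hps, hpY⟩, p, hps, hpb⟩, hps⟩
  constructor
  · have hpt : ∀ t : Set Plane, ∃ x, t ∈ F' → x ∈ t ∧ x ∈ X := fun t => by
      by_cases ht : t ∈ F'
      · obtain ⟨-, x, hx⟩ := hfin'.mem_toFinset.1 ht
        exact ⟨x, fun _ => hx⟩
      · exact ⟨0, fun h => absurd h ht⟩
    choose x hx using hpt
    have hup : ∀ s ∈ F, ((F'.filter fun t => near (x t) s).card : ℝ) ≤ N := by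
      intro s hs
      obtain ⟨hsT, y, hys, -⟩ := hfin.mem_toFinset.1 hs
      rw [hN, le_div_iff₀ (by positivity)]
      refine hT'.card_mul_sq_le hr (x := a⁻¹ • y) (by positivity) _ fun t ht => ?_
      obtain ⟨htF, q, hqs, hq⟩ := Finset.mem_filter.1 ht
      have htT := (hfin'.mem_toFinset.1 htF).1
      refine ⟨htT, fun w hw => ?_⟩
      have h1 : dist w (x t) ≤ D := hT'.dist_le t htT w hw _ (hx t htF).1
      have h2 : dist (a • x t) y ≤ a * δ + a * D := by
        refine (dist_triangle _ q _).trans (add_le_add ?_ ?_)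
        · rw [dist_comm]; exact (Metric.mem_ball.1 hq).le
        · refine (hT.dist_le s hsT q hqs y hys).trans ?_
          exact le_mul_of_one_le_left hD.le ha
      have h3 : dist (x t) (a⁻¹ • y) ≤ δ + D := by
        have : x t = a⁻¹ • a • x t := by rw [smul_smul, inv_mul_cancel₀ ha0.ne', one_smul]
        rw [this, dist_smul₀, Real.norm_of_nonneg (inv_nonneg.2 ha0.le),
          inv_mul_le_iff₀ ha0]
        linarith
      exact (dist_triangle _ (x t) _).trans (by linarith)
    have hdouble : (∑ t ∈ F', ((F.filter (near (x t))).card : ℝ)) =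
        ∑ s ∈ F, ((F'.filter fun t => near (x t) s).card : ℝ) := by
      exact_mod_cast Finset.sum_card_bipartiteAbove_eq_sum_card_bipartiteBelow
        (fun t s => near (x t) s)
    have h1 : (F'.card : ℝ) * (a * δ / D) ≤ F.card * N := by
      calc (F'.card : ℝ) * (a * δ / D) = ∑ t ∈ F', a * δ / D := by simp
        _ ≤ ∑ t ∈ F', ((F.filter (near (x t))).card : ℝ) :=
          Finset.sum_le_sum fun t ht => (div_le_iff₀ hD).2 (hlow _ (hx t ht).2)
        _ ≤ ∑ s ∈ F, N := hdouble ▸ Finset.sum_le_sum hup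
        _ = _ := by simp
    rw [hFc, hFc']
    calc (F'.card : ℝ) * a = (F'.card : ℝ) * (a * δ / D) * (D / δ) := by field_simp
      _ ≤ F.card * N * (D / δ) := by gcongr
      _ ≤ F.card * (N + 1) * (D / δ) := by gcongr; linarith
      _ = _ := by ring
  · rintro ⟨x, hx⟩
    rw [hFc]
    have h1 : a * δ ≤ F.card * D := (hlow x hx).trans (by gcongr; exact Finset.filter_subset _ _)
    calc a = a * δ / δ := by field_simp
      _ ≤ F.card * D / δ := by gcongr
      _ = 1 * (D / δ) * F.card := by ring
      _ ≤ (N + 1) * (D / δ) * F.card := by gcongr; linarith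

/-- A preconnected set meeting a set and its complement meets its frontier. -/
theorem inter_frontier_nonempty_of_isPreconnected {X : Type*} [TopologicalSpace X] {s A : Set X}
    (hs : IsPreconnected s) (h1 : (s ∩ A).Nonempty) (h2 : (s ∩ Aᶜ).Nonempty) :
    (s ∩ frontier A).Nonempty := by
  by_contra hemp
  have hnot : ∀ x ∈ s, x ∉ frontier A := fun x hx h => hemp ⟨x, hx, h⟩
  have hA : ∀ x ∈ s, x ∈ A → x ∈ interior A := fun x hx hxA => by
    by_contra h; exact hnot x hx ⟨subset_closure hxA, h⟩
  have hAc : ∀ x ∈ s, x ∉ A → x ∈ interior Aᶜ := fun x hx hxA => by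
    by_contra h
    refine hnot x hx ?_
    rw [← frontier_compl]
    exact ⟨subset_closure hxA, h⟩
  obtain ⟨x, -, hx1, hx2⟩ := hs _ _ isOpen_interior isOpen_interior
    (fun x hx => (em (x ∈ A)).imp (hA x hx) (hAc x hx))
    (h1.imp fun x hx => ⟨hx.1, hA x hx.1 hx.2⟩) (h2.imp fun x hx => ⟨hx.1, hAc x hx.1 hx.2⟩)
  exact interior_subset hx2 (interior_subset hx1)

/-- Each frontier point of a compact set containing a disk of radius `r` has another frontier point
at distance at least `r`, namely on the ray through the centre of the disk. -/
theorem exists_mem_frontier_le_dist {Δ : Set Plane} (hΔ : IsCompact Δ) {z : Plane} {r : ℝ}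
    (hr : 0 < r) (hz : Metric.ball z r ⊆ Δ) {x : Plane} (hx : x ∈ frontier Δ) :
    ∃ y ∈ frontier Δ, r ≤ dist x y := by
  have hxz : r ≤ dist x z := by
    by_contra! h
    exact hx.2 (mem_interior.2 ⟨_, hz, Metric.isOpen_ball, h⟩)
  have hne : 0 < ‖z - x‖ := by rw [← dist_eq_norm, dist_comm]; linarith
  let ray : Set Plane := (fun s : ℝ => z + s • (z - x)) '' Set.Ici 0
  have hray : IsPreconnected ray := isPreconnected_Ici.image _ (by fun_prop)
  have h1 : (ray ∩ Δ).Nonempty :=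
    ⟨z, ⟨0, by simp, by simp⟩, hz (Metric.mem_ball_self hr)⟩
  have h2 : (ray ∩ Δᶜ).Nonempty := by
    obtain ⟨R, hR⟩ := hΔ.isBounded.subset_closedBall z
    refine ⟨_, ⟨(|R| + 1) / ‖z - x‖, by simp; positivity, rfl⟩, fun h => ?_⟩
    have h3 := hR h
    rw [mem_closedBall_iff_norm, add_sub_cancel_left, norm_smul,
      Real.norm_of_nonneg (by positivity), div_mul_cancel₀ _ hne.ne'] at h3
    linarith [le_abs_self R]
  obtain ⟨_, ⟨s, hs, rfl⟩, hy⟩ := inter_frontier_nonempty_of_isPreconnected hray h1 h2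
  refine ⟨_, hy, hxz.trans ?_⟩
  have hs' : (0 : ℝ) ≤ s := hs
  have : x - (z + s • (z - x)) = (1 + s) • (x - z) := by module
  rw [dist_eq_norm, dist_eq_norm, this, norm_smul, Real.norm_of_nonneg (by positivity)]
  exact le_mul_of_one_le_left (norm_nonneg _) (by linarith)

/-! ### Copies of the prototiles -/

theorem IsClosedDisk.image {t : Set Plane} (ht : IsClosedDisk t) (h : Plane ≃ₜ Plane) :
    IsClosedDisk (h '' t) := by
  obtain ⟨e⟩ := ht
  exact ⟨(h.image t).symm.trans e⟩

namespace IsCopy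

variable {E : Subgroup (Plane ≃ᵢ Plane)} {p q s : Set Plane}

theorem symm (h : IsCopy E p q) : IsCopy E q p := by
  obtain ⟨g, hg, rfl⟩ := h
  refine ⟨g⁻¹, E.inv_mem hg, ?_⟩
  rw [← Set.image_comp, ← IsometryEquiv.coe_mul, inv_mul_cancel]
  exact Set.image_id p

theorem trans (h : IsCopy E p q) (h' : IsCopy E q s) : IsCopy E p s := by
  obtain ⟨g, hg, rfl⟩ := h
  obtain ⟨g', hg', rfl⟩ := h'
  exact ⟨g' * g, E.mul_mem hg' hg, by rw [IsometryEquiv.coe_mul, Set.image_comp]⟩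

theorem image_iff {g : Plane ≃ᵢ Plane} (hg : g ∈ E) : IsCopy E p (g '' q) ↔ IsCopy E p q :=
  ⟨fun h => h.trans (IsCopy.symm ⟨g, hg, rfl⟩), fun h => h.trans ⟨g, hg, rfl⟩⟩

theorem isClosedDisk (h : IsCopy E p q) (hp : IsClosedDisk p) : IsClosedDisk q := by
  obtain ⟨g, -, rfl⟩ := h
  exact hp.image g.toHomeomorph

end IsCopy

/-- Isometries commute with dilations up to a translation: an isometry is affine by the
Mazur–Ulam theorem, so conjugating it by a dilation changes only its translation part. -/
theorem exists_mem_map_smul {E : Subgroup (Plane ≃ᵢ Plane)}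
    (hE : ∀ v : Plane, IsometryEquiv.addRight v ∈ E) {g : Plane ≃ᵢ Plane} (hg : g ∈ E)
    {a : ℝ} (ha : a ≠ 0) : ∃ g' ∈ E, ∀ x, g (a • x) = a • g' x := by
  refine ⟨IsometryEquiv.addRight (a⁻¹ • g 0 - g 0) * g, E.mul_mem (hE _) hg, fun x => ?_⟩
  have hlin : ∀ y, g y = g.toRealAffineIsometryEquiv.linearIsometryEquiv y + g 0 := fun y => by
    have := g.toRealAffineIsometryEquiv.map_vadd 0 y
    simpa using this
  rw [IsometryEquiv.mul_apply, IsometryEquiv.addRight_apply, hlin (a • x), map_smul, hlin x]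
  have : a • a⁻¹ • g 0 = g 0 := by rw [smul_smul, mul_inv_cancel₀ ha, one_smul]
  rw [smul_add, smul_add, smul_sub, this]
  abel

namespace SubstitutionRule

variable {n : ℕ} (S : SubstitutionRule n)

theorem lam_pos : 0 < S.lam := zero_lt_one.trans S.one_lt_lam

/-- The prototiles being finitely many closed disks, all tilings they generate are packings with
the same constants. -/
theorem exists_isPacking : ∃ r D : ℝ, 0 < r ∧ 0 < D ∧
    ∀ Λ, ∀ T ∈ generatedTilings S.E S.p Λ, IsPacking r D T := by
  have hr : ∀ i, ∀ᶠ r in nhdsWithin (0 : ℝ) (Set.Ioi 0), ∃ z, Metric.ball z r ⊆ S.p i := by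
    intro i
    obtain ⟨z, hz⟩ := (S.isTile i).interior_nonempty
    obtain ⟨ε, hε, hball⟩ := Metric.mem_nhds_iff.1 (mem_interior_iff_mem_nhds.1 hz)
    filter_upwards [Ioc_mem_nhdsGT hε] with r hr
    exact ⟨z, (Metric.ball_subset_ball hr.2).trans hball⟩
  have hD : ∀ i, ∀ᶠ D in Filter.atTop, ∀ x ∈ S.p i, ∀ y ∈ S.p i, dist x y ≤ D := by
    intro i
    obtain ⟨C, hC⟩ := Metric.isBounded_iff.1 (S.isTile i).isCompact.isBounded
    filter_upwards [Filter.eventually_ge_atTop C] with D hD x hx y hy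
    exact (hC hx hy).trans hD
  obtain ⟨r, hr, hr0⟩ := ((Filter.eventually_all.2 hr).and self_mem_nhdsWithin).exists
  obtain ⟨D, hD, hD0⟩ := ((Filter.eventually_all.2 hD).and (Filter.eventually_gt_atTop 0)).exists
  refine ⟨r, D, hr0, hD0, fun Λ T hT => ⟨fun t ht => ?_, fun t ht => ?_, hT.1.disjoint⟩⟩
  · obtain ⟨i, g, -, rfl⟩ := hT.2 t ht
    obtain ⟨z, hz⟩ := hr i
    exact ⟨g z, by rw [← IsometryEquiv.image_ball]; exact Set.image_mono hz⟩
  · obtain ⟨i, g, -, rfl⟩ := hT.2 t ht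
    rintro _ ⟨x, hx, rfl⟩ _ ⟨y, hy, rfl⟩
    rw [g.dist_eq]
    exact hD i x hx y hy

theorem rule_finite (j : Fin n) : (S.rule j).Finite := by
  obtain ⟨r, D, hr, -, hpack⟩ := S.exists_isPacking
  have hb : Bornology.IsBounded (S.lam • S.p j) :=
    (S.isTile j).isCompact.isBounded.smul₀ S.lam
  refine ((hpack _ _ (S.rule_mem j)).finite_tilesIn hr hb).subset fun t ht => ⟨ht, ?_⟩
  rw [← (S.rule_mem j).1.cover]
  exact Set.subset_sUnion_of_mem ht

/-! ### One step of the substitution -/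

/-- The tiles replacing the dilated tile `g '' (S.lam • S.p j)`. -/
def children (g : Plane ≃ᵢ Plane) (j : Fin n) : Set (Set Plane) :=
  (fun s : Set Plane => g '' s) '' S.rule j

variable {S}

theorem children_finite (g : Plane ≃ᵢ Plane) (j : Fin n) : (S.children g j).Finite :=
  (S.rule_finite j).image _

theorem ncard_children (g : Plane ≃ᵢ Plane) (j : Fin n) :
    (S.children g j).ncard = (S.rule j).ncard :=
  Set.ncard_image_of_injective _ g.injective.image_injective

theorem ncard_children_isCopy {g : Plane ≃ᵢ Plane} (hg : g ∈ S.E) (i j : Fin n) :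
    {c ∈ S.children g j | IsCopy S.E (S.p i) c}.ncard = S.matrix i j := by
  have : {c ∈ S.children g j | IsCopy S.E (S.p i) c} =
      (fun s : Set Plane => g '' s) '' {t ∈ S.rule j | IsCopy S.E (S.p i) t} := by
    ext c
    constructor
    · rintro ⟨⟨s, hs, rfl⟩, hc⟩
      exact ⟨s, ⟨hs, (IsCopy.image_iff hg).1 hc⟩, rfl⟩
    · rintro ⟨s, ⟨hs, hc⟩, rfl⟩
      exact ⟨⟨s, hs, rfl⟩, (IsCopy.image_iff hg).2 hc⟩
  rw [this, Set.ncard_image_of_injective _ g.injective.image_injective]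
  rfl

theorem sUnion_children (g : Plane ≃ᵢ Plane) (j : Fin n) :
    ⋃₀ S.children g j = g '' (S.lam • S.p j) := by
  rw [← (S.rule_mem j).1.cover, Set.sUnion_eq_biUnion (s := S.rule j), Set.image_iUnion₂, children,
    Set.sUnion_image]

theorem exists_isCopy_of_mem_children {g : Plane ≃ᵢ Plane} (hg : g ∈ S.E) {j : Fin n}
    {c : Set Plane} (hc : c ∈ S.children g j) : ∃ i, IsCopy S.E (S.p i) c := by
  obtain ⟨s, hs, rfl⟩ := hc
  obtain ⟨i, hi⟩ := (S.rule_mem j).2 s hs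
  exact ⟨i, (IsCopy.image_iff hg).2 hi⟩

theorem isCopy_unique {i j : Fin n} {t : Set Plane} (hi : IsCopy S.E (S.p i) t)
    (hj : IsCopy S.E (S.p j) t) : i = j :=
  S.inequivalent i j (hi.trans hj.symm)

variable {T' T : Set (Set Plane)} {idx : Set Plane → Fin n} {g : Set Plane → (Plane ≃ᵢ Plane)}

/-- The index chosen for a tile in a subdivision is its type. -/
theorem isCopy_idx (h : ∀ t ∈ T', g t ∈ S.E ∧ g t '' (S.lam • S.p (idx t)) = S.lam • t)
    {t : Set Plane} (ht : t ∈ T') : IsCopy S.E (S.p (idx t)) t := by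
  obtain ⟨g', hg', hgg'⟩ := exists_mem_map_smul S.translation_mem (h t ht).1 S.lam_pos.ne'
  refine ⟨g', hg', ?_⟩
  have h1 : S.lam • (g' '' S.p (idx t)) = S.lam • t := by
    rw [← (h t ht).2, ← Set.image_smul, ← Set.image_smul, Set.image_image, Set.image_image]
    exact Set.image_congr fun x _ => (hgg' x).symm
  rw [← inv_smul_smul₀ S.lam_pos.ne' (g' '' S.p (idx t)), h1, inv_smul_smul₀ S.lam_pos.ne']

/-- Interiors of children of distinct tiles are disjoint, as they lie in the interiors of the dilated
parents. -/
theorem disjoint_children (hT' : T' ∈ generatedTilings S.E S.p Set.univ)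
    (h : ∀ t ∈ T', g t ∈ S.E ∧ g t '' (S.lam • S.p (idx t)) = S.lam • t)
    {t t' : Set Plane} (ht : t ∈ T') (ht' : t' ∈ T') (hne : t ≠ t') {c c' : Set Plane}
    (hc : c ∈ S.children (g t) (idx t)) (hc' : c' ∈ S.children (g t') (idx t')) :
    Disjoint (interior c) (interior c') := by
  have hsub : ∀ {t c}, t ∈ T' → c ∈ S.children (g t) (idx t) → interior c ⊆ S.lam • interior t := by
    intro t c ht hc
    rw [← interior_smul₀ S.lam_pos.ne', ← (h t ht).2, ← sUnion_children]
    exact interior_mono (Set.subset_sUnion_of_mem hc)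
  refine Disjoint.mono (hsub ht hc) (hsub ht' hc') ?_
  rw [← Set.image_smul, ← Set.image_smul,
    Set.disjoint_image_iff (smul_right_injective _ S.lam_pos.ne')]
  exact hT'.1.disjoint t ht t' ht' hne

theorem IsSubdivision.mem_generatedTilings (hT' : T' ∈ generatedTilings S.E S.p Set.univ)
    (hsub : S.IsSubdivision T' T) : T ∈ generatedTilings S.E S.p Set.univ := by
  obtain ⟨idx, g, h, rfl⟩ := hsub
  have hcopy : ∀ c ∈ ⋃ t ∈ T', S.children (g t) (idx t), ∃ i, IsCopy S.E (S.p i) c := by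
    intro c hc
    simp only [Set.mem_iUnion] at hc
    obtain ⟨t, ht, hc⟩ := hc
    exact exists_isCopy_of_mem_children (h t ht).1 hc
  refine ⟨⟨?_, ?_, ?_, ?_⟩, hcopy⟩
  · exact hT'.1.countable.biUnion fun t _ => (children_finite _ _).countable
  · intro c hc
    obtain ⟨i, hi⟩ := hcopy c hc
    exact hi.isClosedDisk (S.isTile i)
  · refine Set.eq_univ_of_forall fun x => ?_
    have hx : S.lam⁻¹ • x ∈ ⋃₀ T' := hT'.1.cover ▸ Set.mem_univ _
    obtain ⟨t, ht, hxt⟩ := hx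
    have hx' : x ∈ S.lam • t := (Set.mem_smul_set_iff_inv_smul_mem₀ S.lam_pos.ne' _ _).2 hxt
    rw [← (h t ht).2, ← sUnion_children] at hx'
    obtain ⟨c, hc, hxc⟩ := hx'
    exact ⟨c, Set.mem_biUnion ht hc, hxc⟩
  · intro c hc c' hc' hne
    simp only [Set.mem_iUnion] at hc hc'
    obtain ⟨t, ht, hc⟩ := hc
    obtain ⟨t', ht', hc'⟩ := hc'
    by_cases htt' : t = t'
    · subst htt'
      obtain ⟨s, hs, rfl⟩ := hc
      obtain ⟨s', hs', rfl⟩ := hc'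
      have hd := (S.rule_mem (idx t)).1.disjoint s hs s' hs' (fun hss => hne (by rw [hss]))
      have hi : ∀ u : Set Plane, interior (g t '' u) = g t '' interior u := fun u =>
        ((g t).toHomeomorph.image_interior u).symm
      change Disjoint (interior (g t '' s)) (interior (g t '' s'))
      rw [hi, hi]
      exact (Set.disjoint_image_iff (g t).injective).2 hd
    · exact disjoint_children hT' h ht ht' htt' hc hc'

variable (S) in
/-- The type counts of the tiles inside a bounded set `Δ` are obtained by applying the substitution
matrix to the type counts of the tiles of the previous tiling inside `S.lam⁻¹ • Δ`, up to a
correction coming from the tiles subdividing those which meet the frontier. -/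
theorem exists_countCopiesIn_eq : ∃ K : ℝ, 0 < K ∧
    ∀ T' ∈ generatedTilings S.E S.p Set.univ, ∀ T, S.IsSubdivision T' T →
    ∀ Δ : Set Plane, Bornology.IsBounded Δ → ∃ b : Fin n → ℝ,
      (∀ i, (countCopiesIn S.E Δ T (S.p i) : ℝ) =
        ∑ j, (S.matrix i j : ℝ) * countCopiesIn S.E (S.lam⁻¹ • Δ) T' (S.p j) + b i) ∧
      (∀ i, 0 ≤ b i ∧ b i ≤ K * countMeeting (frontier (S.lam⁻¹ • Δ)) T') ∧
      ((tilesIn Δ T).Nonempty ∨ ∀ i, b i = 0) := by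
  classical
  obtain ⟨r, D, hr, -, hpack⟩ := S.exists_isPacking
  refine ⟨∑ j, ((S.rule j).ncard : ℝ) + 1, by positivity, fun T' hT' T hsub Δ hΔ => ?_⟩
  have hT := hsub.mem_generatedTilings hT'
  obtain ⟨idx, g, h, hTeq⟩ := hsub
  set Δ' := S.lam⁻¹ • Δ with hΔ'def
  let Ch : Set Plane → Set (Set Plane) := fun t => S.children (g t) (idx t)
  have hmem : ∀ {c}, c ∈ T ↔ ∃ t ∈ T', c ∈ Ch t := fun {c} => by
    rw [hTeq]; simp [Ch, children]
  have hΔ' : Bornology.IsBounded Δ' := hΔ.smul₀ _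
  have hfr : Bornology.IsBounded (frontier Δ') := hΔ'.closure.subset frontier_subset_closure
  have hA := (hpack _ _ hT').finite_tilesIn hr hΔ'
  have hM := (hpack _ _ hT').finite_tilesMeeting hr hfr
  have hin := (hpack _ _ hT).finite_tilesIn hr hΔ
  have hsubt : ∀ {t c}, t ∈ T' → c ∈ Ch t → c ⊆ S.lam • t := fun {t c} ht hc => by
    rw [← (h t ht).2, ← sUnion_children]
    exact Set.subset_sUnion_of_mem hc
  have hchild : ∀ {t c}, t ∈ tilesIn Δ' T' → c ∈ Ch t → c ∈ tilesIn Δ T := by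
    intro t c ht hc
    refine ⟨hmem.2 ⟨t, ht.1, hc⟩, (hsubt ht.1 hc).trans ?_⟩
    rw [Set.smul_set_subset_iff₀ S.lam_pos.ne']
    exact ht.2
  let B : Set (Set Plane) := tilesIn Δ T \ ⋃ t ∈ tilesIn Δ' T', Ch t
  have hBfin : B.Finite := hin.subset Set.sdiff_subset
  -- the parent of a tile of `B` is connected and meets `Δ'` and its complement
  have hB : B ⊆ ⋃ t ∈ hM.toFinset, Ch t := by
    rintro c ⟨hc, hnot⟩
    obtain ⟨t, ht, hct⟩ := hmem.1 hc.1
    simp only [Set.mem_iUnion]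
    refine ⟨t, hM.mem_toFinset.2 ⟨ht, ?_⟩, hct⟩
    have htΔ : ¬ t ⊆ Δ' := fun hsub => hnot (Set.mem_biUnion (⟨ht, hsub⟩ : t ∈ tilesIn Δ' T') hct)
    obtain ⟨x, hx⟩ := (hT.1.isTile c hc.1).nonempty
    have hxt := (Set.mem_smul_set_iff_inv_smul_mem₀ S.lam_pos.ne' _ _).1 (hsubt ht hct hx)
    refine inter_frontier_nonempty_of_isPreconnected (hT'.1.isTile t ht).isPreconnected
      ⟨_, hxt, Set.smul_mem_smul_set (hc.2 hx)⟩ ?_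
    obtain ⟨y, hy, hyΔ⟩ := Set.not_subset.1 htΔ
    exact ⟨y, hy, hyΔ⟩
  have hBcard : (B.ncard : ℝ) ≤
      (∑ j, ((S.rule j).ncard : ℝ) + 1) * countMeeting (frontier Δ') T' := by
    have h1 : B.ncard ≤ ∑ t ∈ hM.toFinset, (Ch t).ncard :=
      (Set.ncard_le_ncard hB (hM.toFinset.finite_toSet.biUnion fun t _ =>
        children_finite _ _)).trans (Finset.set_ncard_biUnion_le _ _)
    calc (B.ncard : ℝ) ≤ ∑ t ∈ hM.toFinset, ((Ch t).ncard : ℝ) := by exact_mod_cast h1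
      _ ≤ ∑ t ∈ hM.toFinset, (∑ j, ((S.rule j).ncard : ℝ) + 1) := by
        refine Finset.sum_le_sum fun t _ => ?_
        rw [show (Ch t).ncard = _ from ncard_children _ _]
        have := Finset.single_le_sum (f := fun j => ((S.rule j).ncard : ℝ))
          (fun _ _ => Nat.cast_nonneg _) (Finset.mem_univ (idx t))
        linarith
      _ = _ := by
        rw [Finset.sum_const, nsmul_eq_mul, mul_comm, countMeeting,
          Set.ncard_eq_toFinset_card _ hM]
  refine ⟨fun i => ({c ∈ B | IsCopy S.E (S.p i) c}.ncard : ℝ), fun i => ?_, fun i => ⟨by positivity,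
    le_trans ?_ hBcard⟩, ?_⟩
  · have hsplit : {c ∈ tilesIn Δ T | IsCopy S.E (S.p i) c} =
        (⋃ t ∈ tilesIn Δ' T', {c ∈ Ch t | IsCopy S.E (S.p i) c}) ∪
          {c ∈ B | IsCopy S.E (S.p i) c} := by
      ext c
      simp only [Set.mem_union, Set.mem_iUnion, Set.mem_ofPred_eq, B, Set.mem_sdiff, exists_prop,
        not_exists, not_and]
      constructor
      · rintro ⟨hc, hi⟩
        by_cases hex : ∃ t ∈ tilesIn Δ' T', c ∈ Ch t
        · obtain ⟨t, ht, hct⟩ := hex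
          exact Or.inl ⟨t, ht, hct, hi⟩
        · push Not at hex
          exact Or.inr ⟨⟨hc, hex⟩, hi⟩
      · rintro (⟨t, ht, hct, hi⟩ | ⟨⟨hc, -⟩, hi⟩)
        · exact ⟨hchild ht hct, hi⟩
        · exact ⟨hc, hi⟩
    have hfinCh : ∀ t, {c ∈ Ch t | IsCopy S.E (S.p i) c}.Finite := fun t =>
      (children_finite (g t) (idx t)).subset (Set.sep_subset _ _)
    have hcount : ((⋃ t ∈ tilesIn Δ' T', {c ∈ Ch t | IsCopy S.E (S.p i) c}).ncard : ℝ) =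
        ∑ t ∈ hA.toFinset, (S.matrix i (idx t) : ℝ) := by
      rw [hA.ncard_biUnion (fun t _ => hfinCh t), finsum_mem_eq_finite_toFinset_sum _ hA]
      · push_cast
        refine Finset.sum_congr rfl fun t ht => ?_
        rw [show {c ∈ Ch t | IsCopy S.E (S.p i) c}.ncard = _ from
          ncard_children_isCopy (h t (hA.mem_toFinset.1 ht).1).1 i (idx t)]
      · intro t ht t' ht' hne
        refine Set.disjoint_left.2 fun c hc hc' => ?_
        have := disjoint_children hT' h ht.1 ht'.1 hne hc.1 hc'.1
        rw [disjoint_self] at this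
        exact (hT.1.isTile c (hchild ht hc.1).1).interior_nonempty.ne_empty this
    have htypes : ∀ j, (countCopiesIn S.E Δ' T' (S.p j) : ℝ) =
        (hA.toFinset.filter fun t => idx t = j).card := by
      intro j
      rw [countCopiesIn, Set.ncard_eq_toFinset_card _ (hA.subset (Set.sep_subset _ _))]
      congr 2
      ext t
      simp only [Set.Finite.mem_toFinset, Set.mem_ofPred_eq, Finset.mem_filter]
      refine and_congr_right fun ht => ⟨fun hj => isCopy_unique (isCopy_idx h ht.1) hj, ?_⟩
      rintro rfl
      exact isCopy_idx h ht.1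
    rw [countCopiesIn, hsplit, Set.ncard_union_eq ?_ (hA.biUnion fun t _ => hfinCh t)
      (hBfin.subset (Set.sep_subset _ _))]
    · push_cast
      rw [hcount, ← Finset.sum_fiberwise hA.toFinset idx]
      congr 1
      refine Finset.sum_congr rfl fun j _ => ?_
      rw [htypes, Finset.sum_congr rfl (g := fun _ => (S.matrix i j : ℝ)), Finset.sum_const,
        nsmul_eq_mul, mul_comm]
      intro t ht
      rw [(Finset.mem_filter.1 ht).2]
    · refine Set.disjoint_left.2 fun c hc hc' => hc'.1.2 ?_
      simp only [Set.mem_iUnion] at hc ⊢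
      obtain ⟨t, ht, hct⟩ := hc
      exact ⟨t, ht, hct.1⟩
  · exact Nat.cast_le.2 (Set.ncard_le_ncard (Set.sep_subset _ _) hBfin)
  · by_cases hne : (tilesIn Δ T).Nonempty
    · exact Or.inl hne
    · refine Or.inr fun i => ?_
      have : {c ∈ B | IsCopy S.E (S.p i) c} = ∅ :=
        Set.eq_empty_of_forall_notMem fun c hc => hne ⟨c, hc.1.1⟩
      simp only [this, Set.ncard_empty, Nat.cast_zero]

end SubstitutionRule

/-! ### Jordan curves and tilings -/

namespace Bounds

variable {Γ Δ : Set Plane}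

theorem isPreconnected (h : Bounds Γ Δ) : IsPreconnected Γ := by
  obtain ⟨⟨γ, hγ, -, rfl⟩, -, -⟩ := h
  exact isPreconnected_range hγ

theorem isCompact (h : Bounds Γ Δ) : IsCompact Γ := by
  obtain ⟨⟨γ, hγ, -, rfl⟩, -, -⟩ := h
  exact isCompact_range hγ

theorem nonempty (h : Bounds Γ Δ) : Γ.Nonempty := by
  obtain ⟨⟨γ, -, -, rfl⟩, -, -⟩ := h
  exact Set.range_nonempty γ

end Bounds

/-- If a Jordan curve meets at most one tile, then it bounds no tile: it would be the boundary of
that tile, and hence meet the neighbouring tiles. -/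
theorem IsPacking.tilesIn_eq_empty {r D : ℝ} {T : Set (Set Plane)} (hT : IsPacking r D T)
    (hr : 0 < r) (htile : ∀ t ∈ T, IsClosedDisk t) (hcov : ⋃₀ T = Set.univ) {Γ Δ : Set Plane}
    (h : Bounds Γ Δ) (hle : countMeeting Γ T ≤ 1) : tilesIn Δ T = ∅ := by
  by_contra hne
  obtain ⟨s, hsT, hsΔ⟩ := Set.nonempty_iff_ne_empty.2 hne
  have hfin := hT.finite_tilesMeeting hr h.isCompact.isBounded
  have huniq := (Set.ncard_le_one hfin).1 hle
  have htileAt : ∀ y, ∃ t ∈ T, y ∈ t := fun y => by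
    have : y ∈ ⋃₀ T := hcov ▸ Set.mem_univ y
    simpa using this
  obtain ⟨x, hx⟩ := h.nonempty
  obtain ⟨t, ht, hxt⟩ := htileAt x
  have huniq' : ∀ t' ∈ T, ∀ y ∈ t', y ∈ Γ → t' = t := fun t' ht' y hy hyΓ =>
    huniq t' ⟨ht', y, hy, hyΓ⟩ t ⟨ht, x, hxt, hx⟩
  have hΓt : Γ ⊆ t := fun y hy => by
    obtain ⟨t', ht', hyt'⟩ := htileAt y
    rwa [← huniq' t' ht' y hyt' hy]
  have hΔt : Δ ⊆ t := (htile t ht).subset_of_frontier_subset h.2.1.isCompact (h.2.2 ▸ hΓt)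
  have hst : s = t := by
    by_contra hst
    have hd := hT.disjoint s hsT t ht hst
    obtain ⟨y, hy⟩ := (htile s hsT).interior_nonempty
    exact Set.disjoint_left.1 hd hy (interior_mono (hsΔ.trans hΔt) hy)
  have hΔ : Δ = t := Set.Subset.antisymm hΔt (hst ▸ hsΔ)
  have hxfr : x ∈ closure tᶜ := by
    have : x ∈ frontier t := by rw [← hΔ, h.2.2]; exact hx
    rw [← frontier_compl] at this
    exact this.1
  -- near `x`, the complement of `t` is covered by finitely many closed tiles other than `t`
  let U : Set Plane := ⋃ t' ∈ tilesMeeting (Metric.ball x 1) T \ {t}, t'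
  have hU : IsClosed U :=
    ((hT.finite_tilesMeeting hr Metric.isBounded_ball).subset Set.sdiff_subset).isClosed_biUnion
      fun t' ht' => (htile t' ht'.1.1).isCompact.isClosed
  have hsub : Metric.ball x 1 ∩ tᶜ ⊆ U := by
    rintro y ⟨hyb, hyt⟩
    obtain ⟨t', ht', hyt'⟩ := htileAt y
    exact Set.mem_biUnion
      (⟨⟨ht', y, hyt', hyb⟩, fun h => hyt (h ▸ hyt')⟩ : t' ∈ tilesMeeting _ T \ {t}) hyt'
  have hxU : x ∈ U := by
    refine hU.closure_subset (closure_mono hsub ?_)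
    exact Metric.isOpen_ball.inter_closure ⟨Metric.mem_ball_self one_pos, hxfr⟩
  simp only [U, Set.mem_iUnion] at hxU
  obtain ⟨t', ⟨ht', hne'⟩, hxt'⟩ := hxU
  exact hne' (huniq' t' ht'.1 x hxt' hx)

theorem frontier_smul {a : ℝ} (ha : a ≠ 0) (X : Set Plane) :
    frontier (a • X) = a • frontier X :=
  ((Homeomorph.smulOfNeZero a ha).image_frontier X).symm

/-! ### Iterated subdivisions -/

theorem eq_sum_pow_mulVec {n : ℕ} (A : Matrix (Fin n) (Fin n) ℝ) (a b : ℕ → Fin n → ℝ) (m : ℕ)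
    (h : ∀ k < m, a k = A.mulVec (a (k + 1)) + b k) :
    a 0 = ∑ k ∈ Finset.range m, (A ^ k).mulVec (b k) + (A ^ m).mulVec (a m) := by
  induction m with
  | zero => simp
  | succ m ih =>
    rw [ih fun k hk => h k (hk.trans m.lt_succ_self), h m m.lt_succ_self, Finset.sum_range_succ,
      Matrix.mulVec_add, Matrix.mulVec_mulVec, ← pow_succ]
    abel

namespace SubstitutionRule

variable {n : ℕ} {S : SubstitutionRule n}

theorem iterImage_subset (k : ℕ) : S.iterImage k ⊆ generatedTilings S.E S.p Set.univ := by
  induction k with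
  | zero => exact subset_rfl
  | succ k ih =>
    rintro T ⟨T', hT', hsub⟩
    exact hsub.mem_generatedTilings (ih hT')

theorem admissible_subset : S.admissible ⊆ generatedTilings S.E S.p Set.univ :=
  fun _ hT => iterImage_subset 0 (Set.mem_iInter.1 hT 0)

/-- The hierarchy above a tiling is chosen up to a given level only: admissibility does not provide a
coherent infinite sequence of tilings. -/
theorem exists_chain (m : ℕ) {T : Set (Set Plane)} (hT : T ∈ S.iterImage m) :
    ∃ τ : ℕ → Set (Set Plane), τ 0 = T ∧
      (∀ k ≤ m, τ k ∈ generatedTilings S.E S.p Set.univ) ∧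
      ∀ k < m, S.IsSubdivision (τ (k + 1)) (τ k) := by
  induction m generalizing T with
  | zero => exact ⟨fun _ => T, rfl, fun _ _ => hT, fun k hk => absurd hk (Nat.not_lt_zero k)⟩
  | succ m ih =>
    have hTgen := iterImage_subset _ hT
    obtain ⟨T', hT', hsub⟩ := hT
    obtain ⟨τ, h0, hgen, hstep⟩ := ih hT'
    refine ⟨fun k => k.casesOn T τ, rfl, fun k hk => ?_, fun k hk => ?_⟩
    · cases k with
      | zero => exact hTgen
      | succ k => exact hgen k (Nat.le_of_succ_le_succ hk)
    · cases k with
      | zero =>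
        change S.IsSubdivision (τ 0) T
        rwa [h0]
      | succ k => exact hstep k (Nat.lt_of_succ_lt_succ hk)

theorem countIn_eq_sum {T : Set (Set Plane)} {Λ : Set Plane} (hT : T ∈ generatedTilings S.E S.p Λ)
    {Δ : Set Plane} (hfin : (tilesIn Δ T).Finite) :
    countIn Δ T = ∑ i, countCopiesIn S.E Δ T (S.p i) := by
  have : tilesIn Δ T = ⋃ i ∈ (Set.univ : Set (Fin n)),
      {t ∈ tilesIn Δ T | IsCopy S.E (S.p i) t} := by
    ext t
    simp only [Set.mem_iUnion, Set.mem_ofPred_eq, Set.mem_univ, exists_true_left]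
    exact ⟨fun ht => (hT.2 t ht.1).imp fun i hi => ⟨ht, hi⟩, fun ⟨i, ht, _⟩ => ht⟩
  rw [countIn, this, Set.finite_univ.ncard_biUnion (fun i _ => hfin.subset (Set.sep_subset _ _)),
    finsum_mem_univ, finsum_eq_sum_of_fintype]
  · rfl
  · intro i _ j _ hij
    exact Set.disjoint_left.2 fun t hi hj => hij (isCopy_unique hi.2 hj.2)

/-! ### The discrepancy estimate -/

/-- The discrepancy is bounded by a sum over the levels `k` of the hierarchy. At level `k` there
are at most of the order of `L / lam ^ k` supertiles inside `Δ` not contained in a larger supertile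
inside `Δ`, where `L` is the number of tiles meeting `Γ`, and each contributes at most of the order
of `ρ ^ k`. Such supertiles exist only if `lam ^ k` is at most of the order of `L`. -/
theorem exists_discrepancy_le (S : SubstitutionRule n) {ν : Fin n → ℝ} {ρ C₀ : ℝ} (hρ : 0 < ρ)
    (hC₀ : 0 < C₀) (hgrow : ∀ k i j, |((S.matrix ^ k) i j : ℝ) -
      ν i * ∑ l, ((S.matrix ^ k) l j : ℝ)| ≤ C₀ * ρ ^ k) :
    ∃ C : ℝ, 0 < C ∧ ∀ Γ Δ : Set Plane, Bounds Γ Δ → ∀ T ∈ S.admissible, ∃ m : ℕ, ∀ i,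
      |(countCopiesIn S.E Δ T (S.p i) : ℝ) - ν i * (countIn Δ T : ℝ)| ≤
        C * countMeeting Γ T *
          ∑ k ∈ (Finset.range m).filter (fun k => S.lam ^ k ≤ C * countMeeting Γ T),
            (ρ / S.lam) ^ k := by
  have hlam := S.lam_pos
  obtain ⟨r, D, hr, hD, hpack⟩ := S.exists_isPacking
  obtain ⟨K, hK, hstep⟩ := S.exists_countCopiesIn_eq
  obtain ⟨C₁, hC₁, hlen⟩ := exists_countMeeting_mul_le hr hD (show 0 < S.lam⁻¹ * r by positivity)
  refine ⟨C₁ + n * (C₀ * (K * C₁)), by positivity, fun Γ Δ h T hT => ?_⟩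
  set L : ℝ := (countMeeting Γ T : ℝ) with hL
  have hΔc := h.2.1.isCompact
  have hTgen := admissible_subset hT
  obtain ⟨R, hR⟩ := hΔc.isBounded.subset_closedBall 0
  obtain ⟨m, hm⟩ := pow_unbounded_of_one_lt (|R| / r) S.one_lt_lam
  obtain ⟨τ, hτ0, hτ, hsub⟩ := exists_chain m (Set.mem_iInter.1 hT m)
  refine ⟨m, fun i => ?_⟩
  let Δs : ℕ → Set Plane := fun k => S.lam⁻¹ ^ k • Δ
  have hΔs : ∀ k, S.lam⁻¹ • Δs k = Δs (k + 1) := fun k => by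
    simp only [Δs, smul_smul, pow_succ']
  have hΔsc : ∀ k, IsCompact (Δs k) := fun k => hΔc.smul _
  let a : ℕ → Fin n → ℝ := fun k j => countCopiesIn S.E (Δs k) (τ k) (S.p j)
  have hex : ∀ k, ∃ b : Fin n → ℝ, k < m →
      (∀ i, a k i = ∑ j, (S.matrix i j : ℝ) * a (k + 1) j + b i) ∧
      (∀ i, 0 ≤ b i ∧ b i ≤ K * countMeeting (frontier (Δs (k + 1))) (τ (k + 1))) ∧
      ((tilesIn (Δs k) (τ k)).Nonempty ∨ ∀ i, b i = 0) := by
    intro k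
    by_cases hk : k < m
    · obtain ⟨b, hb⟩ := hstep _ (hτ (k + 1) hk) _ (hsub k hk) (Δs k) (hΔsc k).isBounded
      rw [hΔs] at hb
      exact ⟨b, fun _ => hb⟩
    · exact ⟨0, fun h => absurd h hk⟩
  choose b hb using hex
  let A : Matrix (Fin n) (Fin n) ℝ := S.matrix.map (Nat.cast : ℕ → ℝ)
  have hApow : ∀ k i j, (A ^ k) i j = ((S.matrix ^ k) i j : ℝ) := fun k i j => by
    have : A ^ k = (S.matrix ^ k).map (Nat.cast : ℕ → ℝ) :=
      (map_pow (Nat.castRingHom ℝ).mapMatrix S.matrix k).symm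
    rw [this, Matrix.map_apply]
  have ham : a m = 0 := by
    funext j
    have hempty : tilesIn (Δs m) (τ m) = ∅ := by
      refine Set.eq_empty_of_forall_notMem fun t ht => ?_
      have h1 : Δs m ⊆ Metric.closedBall 0 (S.lam⁻¹ ^ m * |R|) := by
        rintro _ ⟨x, hx, rfl⟩
        have hx' : ‖x‖ ≤ |R| := by
          have := hR hx
          rw [mem_closedBall_zero_iff] at this
          exact this.trans (le_abs_self R)
        rw [mem_closedBall_zero_iff, norm_smul, Real.norm_of_nonneg (by positivity)]
        gcongr
      have h2 := (hpack _ _ (hτ m le_rfl)).card_mul_sq_le hr (x := 0)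
        (R := S.lam⁻¹ ^ m * |R|) (by positivity) {t} (fun s hs => by
          rw [Finset.mem_singleton] at hs
          exact hs ▸ ⟨ht.1, ht.2.trans h1⟩)
      rw [Finset.card_singleton, Nat.cast_one, one_mul,
        sq_le_sq₀ hr.le (by positivity), inv_pow, ← div_eq_inv_mul,
        le_div_iff₀ (by positivity)] at h2
      rw [div_lt_iff₀ hr] at hm
      linarith
    simp [a, countCopiesIn, hempty]
  have ha0 : a 0 = ∑ k ∈ Finset.range m, (A ^ k).mulVec (b k) := by
    rw [eq_sum_pow_mulVec A a b m fun k hk => funext fun i => (hb k hk).1 i, ham]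
    simp
  have ha0' : ∀ l, a 0 l = ∑ k ∈ Finset.range m, ∑ j, ((S.matrix ^ k) l j : ℝ) * b k j := by
    intro l
    rw [ha0, Finset.sum_apply]
    simp only [Matrix.mulVec, dotProduct, hApow]
  have hΔ0 : Δs 0 = Δ := by simp [Δs]
  have hcount : (countCopiesIn S.E Δ T (S.p i) : ℝ) - ν i * (countIn Δ T : ℝ) =
      ∑ k ∈ Finset.range m, ∑ j, (((S.matrix ^ k) i j : ℝ) -
        ν i * ∑ l, ((S.matrix ^ k) l j : ℝ)) * b k j := by
    have h1 : ∀ l, (countCopiesIn S.E Δ T (S.p l) : ℝ) = a 0 l := fun l => by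
      simp only [a, hΔ0, hτ0]
    rw [countIn_eq_sum hTgen ((hpack _ _ hTgen).finite_tilesIn hr hΔc.isBounded)]
    push_cast
    simp only [h1, ha0', sub_mul, Finset.sum_sub_distrib, Finset.mul_sum, Finset.sum_mul]
    congr 1
    rw [Finset.sum_comm]
    refine Finset.sum_congr rfl fun k _ => ?_
    rw [Finset.sum_comm]
    exact Finset.sum_congr rfl fun j _ => Finset.sum_congr rfl fun l _ => by ring
  have hL0 : 0 ≤ L := Nat.cast_nonneg _
  have hCle : C₁ ≤ C₁ + n * (C₀ * (K * C₁)) := le_add_of_nonneg_right (by positivity)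
  -- the two estimates available at a level with a supertile inside `Δ`
  have hlevel : ∀ k < m, (tilesIn (Δs k) (τ k)).Nonempty →
      (∀ j, b k j ≤ K * C₁ * L / S.lam ^ k) ∧ S.lam ^ k ≤ C₁ * L := by
    rintro k hk ⟨t, ht, htΔ⟩
    obtain ⟨z, hz⟩ := (hpack _ _ (hτ k hk.le)).exists_ball_subset t ht
    have hball : Metric.ball (S.lam⁻¹ • z) (S.lam⁻¹ * r) ⊆ Δs (k + 1) := by
      have h1 := smul_ball (inv_ne_zero hlam.ne') z r
      rw [Real.norm_of_nonneg (inv_nonneg.2 hlam.le)] at h1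
      rw [← h1, ← hΔs]
      exact Set.smul_set_mono (hz.trans htΔ)
    have hfr : frontier (Δs (k + 1)) = S.lam⁻¹ ^ (k + 1) • Γ := by
      rw [← h.2.2]; exact frontier_smul (by positivity) _
    have hback : S.lam ^ (k + 1) • frontier (Δs (k + 1)) = Γ := by
      rw [hfr, smul_smul, ← mul_pow, mul_inv_cancel₀ hlam.ne', one_pow, one_smul]
    obtain ⟨h1, h2⟩ := hlen T (τ (k + 1)) (hpack _ _ hTgen) (hpack _ _ (hτ (k + 1) hk)) hTgen.1.cover
      (S.lam ^ (k + 1)) (one_le_pow₀ S.one_lt_lam.le) (frontier (Δs (k + 1)))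
      (by rw [hfr]; exact h.isPreconnected.image _ (by fun_prop))
      (by rw [hfr]; exact h.isCompact.isBounded.smul₀ _)
      (fun x hx => exists_mem_frontier_le_dist (hΔsc (k + 1)) (by positivity) hball hx)
    rw [hback, ← hL] at h1 h2
    have hpow : S.lam ^ k ≤ S.lam ^ (k + 1) := pow_le_pow_right₀ S.one_lt_lam.le k.le_succ
    refine ⟨fun j => ?_, hpow.trans (h2 (by rw [hfr]; exact h.nonempty.smul_set))⟩
    rw [le_div_iff₀ (by positivity)]
    calc b k j * S.lam ^ k
        ≤ K * countMeeting (frontier (Δs (k + 1))) (τ (k + 1)) * S.lam ^ (k + 1) := by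
          gcongr
          exact ((hb k hk).2.1 j).2
      _ = K * (countMeeting (frontier (Δs (k + 1))) (τ (k + 1)) * S.lam ^ (k + 1)) := by ring
      _ ≤ K * (C₁ * L) := by gcongr
      _ = _ := by ring
  have hterm : ∀ k ∈ Finset.range m, |∑ j, (((S.matrix ^ k) i j : ℝ) -
      ν i * ∑ l, ((S.matrix ^ k) l j : ℝ)) * b k j| ≤
      if S.lam ^ k ≤ (C₁ + n * (C₀ * (K * C₁))) * L then
        (C₁ + n * (C₀ * (K * C₁))) * L * (ρ / S.lam) ^ k else 0 := by
    intro k hk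
    rw [Finset.mem_range] at hk
    rcases (hb k hk).2.2 with hne | hzero
    · obtain ⟨h1, h2⟩ := hlevel k hk hne
      rw [if_pos (h2.trans (by gcongr))]
      calc _ ≤ ∑ j, |(((S.matrix ^ k) i j : ℝ) - ν i * ∑ l, ((S.matrix ^ k) l j : ℝ)) * b k j| :=
            Finset.abs_sum_le_sum_abs _ _
        _ ≤ ∑ j : Fin n, C₀ * ρ ^ k * (K * C₁ * L / S.lam ^ k) := by
            refine Finset.sum_le_sum fun j _ => ?_
            rw [abs_mul, abs_of_nonneg ((hb k hk).2.1 j).1]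
            exact mul_le_mul (hgrow k i j) (h1 j) ((hb k hk).2.1 j).1 (by positivity)
        _ = n * (C₀ * (K * C₁)) * L * (ρ / S.lam) ^ k := by
            rw [Finset.sum_const, Finset.card_univ, Fintype.card_fin, nsmul_eq_mul, div_pow]
            ring
        _ ≤ _ := by gcongr; linarith
    · have : ∑ j, (((S.matrix ^ k) i j : ℝ) -
          ν i * ∑ l, ((S.matrix ^ k) l j : ℝ)) * b k j = 0 :=
        Finset.sum_eq_zero fun j _ => by rw [hzero j, mul_zero]
      rw [this, abs_zero]
      split_ifs <;> positivity
  rw [hcount, Finset.mul_sum, Finset.sum_filter]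
  exact (Finset.abs_sum_le_sum_abs _ _).trans (Finset.sum_le_sum hterm)

end SubstitutionRule

/-- The number of powers of `a` below `C * L` is logarithmic in `L`. -/
theorem exists_card_filter_pow_le {a C : ℝ} (ha : 1 < a) (hC : 0 < C) :
    ∃ K : ℝ, 0 < K ∧ ∀ L : ℝ, 2 ≤ L → ∀ m : ℕ,
      (((Finset.range m).filter fun k => a ^ k ≤ C * L).card : ℝ) ≤ K * Real.log L := by
  have hla := Real.log_pos ha
  have hl2 : 0 < Real.log 2 := Real.log_pos one_lt_two
  refine ⟨(|Real.log C| / Real.log 2 + 1) / Real.log a + 1 / Real.log 2, by positivity,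
    fun L hL m => ?_⟩
  have hL0 : 0 < L := by linarith
  have hlog : Real.log 2 ≤ Real.log L := Real.log_le_log two_pos hL
  have h1 : 1 ≤ Real.log L / Real.log 2 := (one_le_div hl2).2 hlog
  set Q := (|Real.log C| + Real.log L) / Real.log a
  have hQ : 0 ≤ Q := div_nonneg (add_nonneg (abs_nonneg _) (hl2.le.trans hlog)) hla.le
  have hsub : ((Finset.range m).filter fun k => a ^ k ≤ C * L) ⊆ Finset.range (⌊Q⌋₊ + 1) := by
    intro k hk
    have h2 := (Finset.mem_filter.1 hk).2
    rw [Finset.mem_range, Nat.lt_succ_iff, Nat.le_floor_iff hQ, le_div_iff₀ hla]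
    have h3 := Real.log_le_log (by positivity) h2
    rw [Real.log_pow, Real.log_mul hC.ne' hL0.ne'] at h3
    linarith [le_abs_self (Real.log C)]
  calc (((Finset.range m).filter fun k => a ^ k ≤ C * L).card : ℝ) ≤ ⌊Q⌋₊ + 1 := by
        exact_mod_cast (Finset.card_le_card hsub).trans_eq (Finset.card_range _)
    _ ≤ Q + 1 := by gcongr; exact Nat.floor_le hQ
    _ ≤ (|Real.log C| * (Real.log L / Real.log 2) + Real.log L) / Real.log a +
        Real.log L / Real.log 2 := by
        refine add_le_add ?_ h1
        simp only [Q]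
        gcongr
        exact le_mul_of_one_le_right (abs_nonneg _) h1
    _ = _ := by ring

theorem theorem1 (n : ℕ) (M : Matrix (Fin n) (Fin n) ℕ) 
    (hM : (M.map (Nat.cast : ℕ → ℝ)).IsPrimitive) :
    ∃ ν : Fin n → ℝ, (∀ i, 0 < ν i) ∧
      ∀ S : SubstitutionRule n, S.matrix = M →
        (∀ Γ Δ : Set Plane, Bounds Γ Δ → ∀ T ∈ S.admissible,
          (tilesIn Δ T).Finite ∧ (tilesMeeting Γ T).Finite) ∧
        (secondModulus M < S.lam →
          ∃ K : ℝ, 0 < K ∧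
            ∀ Γ Δ : Set Plane, Bounds Γ Δ → ∀ T ∈ S.admissible, ∀ i,
              |(countCopiesIn S.E Δ T (S.p i) : ℝ) - ν i * (countIn Δ T : ℝ)|
                ≤ K * (countMeeting Γ T : ℝ)) ∧
        (secondModulus M = S.lam →
          (∀ η : ℂ, (complexEnd M).HasEigenvalue η → ‖η‖ = S.lam → IsSemisimpleEigenvalue M η) →
          ∃ K : ℝ, 0 < K ∧
            ∀ Γ Δ : Set Plane, Bounds Γ Δ → ∀ T ∈ S.admissible, ∀ i,
              |(countCopiesIn S.E Δ T (S.p i) : ℝ) - ν i * (countIn Δ T : ℝ)|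
                ≤ K * (countMeeting Γ T : ℝ) * Real.log (countMeeting Γ T : ℝ)) := by

  obtain ⟨ν, hν, hfreq⟩ := exists_frequencies M hM
  refine ⟨ν, hν, ?_⟩
  rintro S rfl
  have hlam := S.lam_pos
  obtain ⟨r, D, hr, -, hpack⟩ := S.exists_isPacking
  refine ⟨fun Γ Δ h T hT => ?_, fun hlt => ?_, fun heq hss => ?_⟩
  · have hTgen := SubstitutionRule.admissible_subset hT
    exact ⟨(hpack _ _ hTgen).finite_tilesIn hr h.2.1.isCompact.isBounded,
      (hpack _ _ hTgen).finite_tilesMeeting hr h.isCompact.isBounded⟩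
  · obtain ⟨ρ, hρ, hρlam⟩ := exists_between (max_lt hlt hlam)
    have hρ0 : 0 < ρ := (le_max_right _ _).trans_lt hρ
    obtain ⟨C₀, hC₀, hgrow⟩ := hfreq ρ hρ0 (Or.inl ((le_max_left _ _).trans_lt hρ))
    obtain ⟨C, hC, hdisc⟩ := S.exists_discrepancy_le hρ0 hC₀ hgrow
    have hq : ρ / S.lam < 1 := (div_lt_one hlam).2 hρlam
    have hq0 : 0 ≤ ρ / S.lam := by positivity
    refine ⟨C * (1 - ρ / S.lam)⁻¹, mul_pos hC (inv_pos.2 (sub_pos.2 hq)),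
      fun Γ Δ h T hT i => ?_⟩
    obtain ⟨m, hm⟩ := hdisc Γ Δ h T hT
    refine (hm i).trans ?_
    rw [mul_right_comm]
    gcongr
    rw [← tsum_geometric_of_lt_one hq0 hq]
    exact (summable_geometric_of_lt_one hq0 hq).sum_le_tsum _ fun k _ => pow_nonneg hq0 k
  · obtain ⟨C₀, hC₀, hgrow⟩ := hfreq S.lam hlam (Or.inr ⟨heq, hss⟩)
    obtain ⟨C, hC, hdisc⟩ := S.exists_discrepancy_le hlam hC₀ hgrow
    obtain ⟨K, hK, hcard⟩ := exists_card_filter_pow_le S.one_lt_lam hC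
    refine ⟨C * K, mul_pos hC hK, fun Γ Δ h T hT i => ?_⟩
    have hTgen := SubstitutionRule.admissible_subset hT
    rcases Nat.lt_or_ge 1 (countMeeting Γ T) with h2 | h1
    · obtain ⟨m, hm⟩ := hdisc Γ Δ h T hT
      refine (hm i).trans ?_
      simp only [div_self hlam.ne', one_pow, Finset.sum_const, nsmul_eq_mul, mul_one]
      calc _ ≤ C * countMeeting Γ T * (K * Real.log (countMeeting Γ T)) := by
            gcongr
            exact hcard _ (by exact_mod_cast h2) m
        _ = _ := by ring
    · -- here the logarithm may vanish, but `Γ` encloses no tile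
      have hempty : tilesIn Δ T = ∅ :=
        (hpack _ _ hTgen).tilesIn_eq_empty hr hTgen.1.isTile hTgen.1.cover h h1
      simp only [countCopiesIn, countIn, hempty, Set.mem_empty_iff_false, false_and,
        Set.ofPred_false, Set.ncard_empty, Nat.cast_zero, mul_zero, sub_zero, abs_zero]
      have := Real.log_natCast_nonneg (countMeeting Γ T)
      positivity
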